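/- Let $\mathbb{R}_{\max}=(\mathbb{R}\cup\{-\infty\},\oplus,\otimes)$ with $\oplus=\max$, $\otimes=+$, let $k\ge 1$, and use $\otimes$ also for matrix products over $\mathbb{R}_{\max}$. Let $\mathbb{PR}^k$ be the quotient of $\mathbb{R}^k$ by $u\simeq v\iff\exists a\in\mathbb{R},\ u=a\otimes v$, and $\pi$ the projection; write also $\pi(A)$ for the map $\pi(u)\mapsto\pi(A\otimes u)$. Let $(\Omega,\mathcal F,P)$ be a probability space with an invertible bimeasurable map $\theta$ preserving $P$. Let $A(0)$ be a random $k\times k$ matrix taking finitely many values, each of them irreducible (for all $i,j$ there is $n\ge 1$ with $(A^{\otimes n})_{ij}>-\infty$) with entries in $\mathbb{Q}\cup\{-\infty\}$, and let $A(n)=A(0)\circ\theta^n$. Assume that the $A(n)$, $n\ge 0$, are i.i.d., or that $\theta$ is ergodic. Assume also that for some $n$, $P\{D(A(n)\otimes\cdots\otimes A(0))<\infty\}>0$, where $D(M)=\sup_{u,v\in\mathbb{R}^k}d(M\otimes u,M\otimes v)$ and $d(u,v)=\max_i(u_i-v_i)+\max_i(v_i-u_i)$. For a (possibly random) initial condition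 $x_0$ in $\mathbb{R}^k$ let $x(0,x_0)=x_0$ and $x(n+1,x_0)=A(n)\otimes x(n,x_0)$. A stationary regime of the model is a probability distribution on $\Omega\times\mathbb{PR}^k$ with $\Omega$-marginal $P$ that is invariant under $(\omega,z)\mapsto(\theta\omega,\pi(A(0,\omega))z)$. In particular, each random variable $Z:\Omega\to\mathbb{PR}^k$ with $Z\circ\theta=\pi(A(0))Z$ a.s. gives one, the law of $(\omega,Z(\omega))$. A deterministic matrix $C$ is a pattern of $\{A(n)\}$ if there is $N\ge 1$ such that for all $\eta>0$, with positive probability $A(N-1)\otimes\cdots\otimes A(0)$ is within distance less than $\eta$ of $C$ in the supremum norm (entries $-\infty$ having to agree). $C$ is of rank 1 if it has a column $C_{\cdot j}$ such that every other column is parallel to $\alpha\otimes C_{\cdot j}$ for some $\alpha\in\mathbb{R}_{\max}$. **Theorem.** The model has a unique stationary regime if and only if there is a matrix $C$ of rank 1 that is a pattern of $\{A(n)\}$. When there is a unique stationary regime, it is given by a random variable $Z:\Omega\to\mathbb{PR}^k$ with $Z\circ\theta=\pi(A(0))Z$ a.s., $Z$ is a.s. unique with this property, and for every random initial condition $x_0$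 in $\mathbb{R}^k$ the sequence $\{\pi(x(n,x_0))\}$ converges to $\{Z\circ\theta^n\}$ with strong coupling: almost surely there is a finite $n\ge 0$ such that $\pi(x(n+l,x_0))\circ\theta^{-(n+l)}=Z$ for all $l\ge 0$. -/

import Mathlib

open MeasureTheory ProbabilityTheory

namespace MaxPlus

/-- Square matrices of size `k` over the (max,+) semiring `ℝ ∪ {-∞}`; `⊥` is `-∞`. -/
abbrev MaxMat (k : ℕ) : Type := Matrix (Fin k) (Fin k) (WithBot ℝ)

/-- The (max,+) product `(A ⊗ B) i j = max_l (A i l + B l j)`. -/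
noncomputable def mul {k : ℕ} (A B : MaxMat k) : MaxMat k :=
  fun i j => Finset.univ.sup fun l => A i l + B l j

/-- The (max,+) identity matrix. -/
noncomputable def one (k : ℕ) : MaxMat k :=
  fun i j => if i = j then 0 else ⊥

/-- The (max,+) power `A ⊗ ⋯ ⊗ A` (`n` factors). -/
noncomputable def pow {k : ℕ} (A : MaxMat k) : ℕ → MaxMat k
  | 0 => one k
  | n + 1 => mul A (pow A n)

/-- Irreducibility: the graph of `A` is strongly connected, i.e. all `i, j` are joined by a path of
some length `n ≥ 1`. (For `k ≥ 2` allowing `n = 0` gives the same notion; for `k = 1` the condition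
`1 ≤ n` only rules out the matrix `(-∞)`, which does not map finite vectors to finite vectors.) -/
def Irred {k : ℕ} (A : MaxMat k) : Prop :=
  ∀ i j, ∃ n : ℕ, 1 ≤ n ∧ pow A n i j ≠ ⊥

/-- All entries are in `ℚ ∪ {-∞}`. -/
def HasRationalEntries {k : ℕ} (A : MaxMat k) : Prop :=
  ∀ i j, A i j = ⊥ ∨ ∃ q : ℚ, A i j = ((q : ℝ) : WithBot ℝ)

/-- The (max,+) matrix-vector product `(A ⊗ u) i = max_j (A i j + u j)` on finite vectors.
The default value `u i` is used only if row `i` of `A` is identically `-∞`, which never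
happens for irreducible matrices and their products (see `coe_mulVec`). -/
noncomputable def mulVec {k : ℕ} (A : MaxMat k) (u : Fin k → ℝ) : Fin k → ℝ :=
  fun i => (Finset.univ.sup fun j => A i j + (u j : WithBot ℝ)).unbotD (u i)

theorem row_ne_bot {k : ℕ} {A : MaxMat k} (hA : Irred A) (i : Fin k) : ∃ j, A i j ≠ ⊥ := by
  obtain ⟨n, hn, h⟩ := hA i i
  by_contra hc
  push Not at hc
  obtain ⟨m, rfl⟩ : ∃ m, n = m + 1 := ⟨n - 1, by omega⟩
  apply h
  simp [pow, mul, hc]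

theorem coe_mulVec {k : ℕ} {A : MaxMat k} {i : Fin k} (h : ∃ j, A i j ≠ ⊥) (u : Fin k → ℝ) :
    (mulVec A u i : WithBot ℝ) = Finset.univ.sup fun j => A i j + (u j : WithBot ℝ) := by
  obtain ⟨j, hj⟩ := h
  have hne : (Finset.univ.sup fun j => A i j + (u j : WithBot ℝ)) ≠ ⊥ := by
    intro hb
    have := (Finset.sup_eq_bot_iff _ _).1 hb j (Finset.mem_univ j)
    simp [WithBot.add_eq_bot, hj] at this
  obtain ⟨r, hr⟩ := WithBot.ne_bot_iff_exists.1 hne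
  simp only [mulVec]
  rw [← hr]
  rfl

theorem sup_add_const {ι : Type*} (s : Finset ι) (f : ι → WithBot ℝ) (a : ℝ) :
    (s.sup fun j => (a : WithBot ℝ) + f j) = (a : WithBot ℝ) + s.sup f := by
  classical
  induction s using Finset.induction_on with
  | empty => simp
  | insert x s _ ih =>
    rw [Finset.sup_insert, Finset.sup_insert, ih]
    exact ((add_right_mono (a := (a : WithBot ℝ))).map_max).symm

theorem mulVec_shift {k : ℕ} (A : MaxMat k) {u v : Fin k → ℝ} {a : ℝ}
    (h : ∀ i, u i = a + v i) (i : Fin k) : mulVec A u i = a + mulVec A v i := by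
  have : (Finset.univ.sup fun j => A i j + (u j : WithBot ℝ)) =
      (a : WithBot ℝ) + Finset.univ.sup fun j => A i j + (v j : WithBot ℝ) := by
    rw [← sup_add_const]
    refine Finset.sup_congr rfl fun j _ => ?_
    rw [h j, WithBot.coe_add, add_left_comm]
  simp only [mulVec]
  rw [this, h i]
  cases (Finset.univ.sup fun j => A i j + (v j : WithBot ℝ)) <;> rfl

/-- The parallelism relation on finite vectors: `u = a ⊗ v` for some real `a`. -/
def projSetoid (k : ℕ) : Setoid (Fin k → ℝ) where
  r u v := ∃ a : ℝ, ∀ i, u i = a + v i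
  iseqv :=
    { refl := fun _ => ⟨0, fun _ => (zero_add _).symm⟩
      symm := by
        rintro u v ⟨a, h⟩
        exact ⟨-a, fun i => by rw [h i]; ring⟩
      trans := by
        rintro u v w ⟨a, h⟩ ⟨b, h'⟩
        exact ⟨a + b, fun i => by rw [h i, h' i]; ring⟩ }

/-- The (max,+) projective space `ℙℝ^k`, with the quotient (= Borel) σ-algebra. -/
abbrev ProjSpace (k : ℕ) : Type := Quotient (projSetoid k)

/-- The canonical projection `π : ℝ^k → ℙℝ^k`. -/
def proj {k : ℕ} (u : Fin k → ℝ) : ProjSpace k := Quotient.mk (projSetoid k) u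

/-- The map `π(u) ↦ π(A ⊗ u)` of `ℙℝ^k`. -/
noncomputable def act {k : ℕ} (A : MaxMat k) : ProjSpace k → ProjSpace k :=
  Quotient.map (mulVec A) (fun _ _ ⟨a, h⟩ => ⟨a, mulVec_shift A h⟩)

/-- The projective distance `d(u,v) = max_i (u i - v i) + max_i (v i - u i)`. -/
noncomputable def projDist {k : ℕ} (u v : Fin k → ℝ) : ℝ :=
  (⨆ i, (u i - v i)) + ⨆ i, (v i - u i)

/-- The projective diameter `D(A) = sup_{u,v ∈ ℝ^k} d(A ⊗ u, A ⊗ v) ∈ [0,∞]`. -/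
noncomputable def projDiam {k : ℕ} (A : MaxMat k) : ENNReal :=
  ⨆ (u : Fin k → ℝ) (v : Fin k → ℝ), ENNReal.ofReal (projDist (mulVec A u) (mulVec A v))

/-- Parallelism of vectors over `ℝ ∪ {-∞}`, i.e. equality of their projective classes. -/
def Parallel {k : ℕ} (u v : Fin k → WithBot ℝ) : Prop :=
  ∃ a : ℝ, ∀ i, u i = (a : WithBot ℝ) + v i

/-- `A` is of rank `r`: there is a set `J` of `r` columns, pairwise non-parallel, such that each
other column is parallel to a (max,+) linear combination of the columns in `J`. -/
def IsOfRank {k : ℕ} (A : MaxMat k) (r : ℕ) : Prop :=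
  ∃ J : Finset (Fin k), J.card = r ∧
    (∀ i ∈ J, ∀ j ∈ J, i ≠ j → ¬ Parallel (fun s => A s i) (fun s => A s j)) ∧
    ∀ i, i ∉ J → ∃ α : Fin k → WithBot ℝ,
      Parallel (fun s => A s i) (fun s => J.sup fun j => α j + A s j)

/-- The ball of centre `C` and radius `η` for the supremum norm: `-∞` entries agree, and finite
entries differ by less than `η`. -/
def supBall {k : ℕ} (C : MaxMat k) (η : ℝ) : Set (MaxMat k) :=
  {B | ∀ i j, (C i j = ⊥ ∧ B i j = ⊥) ∨
    ∃ c b : ℝ, C i j = (c : WithBot ℝ) ∧ B i j = (b : WithBot ℝ) ∧ |b - c| < η}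

section Model

variable {Ω : Type*} [MeasurableSpace Ω] {k : ℕ}

/-- The matrix sequence `A(n) = A ∘ θ^n`. -/
def matSeq (θ : Ω ≃ᵐ Ω) (A : Ω → MaxMat k) (n : ℕ) (ω : Ω) : MaxMat k := A (θ^[n] ω)

/-- The product `A(n-1) ⊗ ⋯ ⊗ A(0)`. -/
noncomputable def matProd (θ : Ω ≃ᵐ Ω) (A : Ω → MaxMat k) : ℕ → Ω → MaxMat k
  | 0, _ => one k
  | n + 1, ω => mul (matSeq θ A n ω) (matProd θ A n ω)

/-- The recursion `x(n+1) = A(n) ⊗ x(n)`, `x(0) = x₀`, with a possibly random initial value. -/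
noncomputable def state (θ : Ω ≃ᵐ Ω) (A : Ω → MaxMat k) (x₀ : Ω → Fin k → ℝ) :
    ℕ → Ω → Fin k → ℝ
  | 0, ω => x₀ ω
  | n + 1, ω => mulVec (matSeq θ A n ω) (state θ A x₀ n ω)

/-- `C` is a pattern of `{A(n)}`: for some `N ≥ 1` it is in the support of
`A(N-1) ⊗ ⋯ ⊗ A(0)`. -/
def IsPattern (P : Measure Ω) (θ : Ω ≃ᵐ Ω) (A : Ω → MaxMat k) (C : MaxMat k) : Prop :=
  ∃ N : ℕ, 1 ≤ N ∧ ∀ η : ℝ, 0 < η → 0 < P {ω | matProd θ A N ω ∈ supBall C η}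

/-- A random variable `Z : Ω → ℙℝ^k` generates a stationary regime `{Z ∘ θ^n}` of `{π(x(n))}` if
`Z ∘ θ = π(A(0)) Z` almost surely. -/
def IsStationarySolution (P : Measure Ω) (θ : Ω ≃ᵐ Ω) (A : Ω → MaxMat k)
    (Z : Ω → ProjSpace k) : Prop :=
  Measurable Z ∧ ∀ᵐ ω ∂P, Z (θ ω) = act (A ω) (Z ω)

/-- A (weak) stationary regime of `{π(x(n))}`: a distribution on `Ω × ℙℝ^k` with `Ω`-marginal `P`
that is invariant under `(ω, z) ↦ (θ ω, π(A(0, ω)) z)`. -/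
def IsStationaryRegime (P : Measure Ω) (θ : Ω ≃ᵐ Ω) (A : Ω → MaxMat k)
    (Q : Measure (Ω × ProjSpace k)) : Prop :=
  Q.map Prod.fst = P ∧ MeasurePreserving (fun p => (θ p.1, act (A p.1) p.2)) Q Q

/-- The model has exactly one stationary regime. -/
def HasUniqueStationaryRegime (P : Measure Ω) (θ : Ω ≃ᵐ Ω) (A : Ω → MaxMat k) : Prop :=
  ∃! Q : Measure (Ω × ProjSpace k), IsStationaryRegime P θ A Q

/-- Strong coupling of `{X n}` to `{Y ∘ θ^n}`: almost surely there is a finite `n` with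
`X_{n+l} ∘ θ^{-(n+l)} = Y` for all `l ≥ 0`. -/
def StronglyCouples {E : Type*} (P : Measure Ω) (θ : Ω ≃ᵐ Ω) (X : ℕ → Ω → E) (Y : Ω → E) : Prop :=
  ∀ᵐ ω ∂P, ∃ n : ℕ, ∀ l : ℕ, X (n + l) (θ.symm^[n + l] ω) = Y ω

end Model

end MaxPlus

/-!
The proof rests on the action of the matrix products on projective space. Write `back n ω` for the
map of `A(-1) ⊗ ⋯ ⊗ A(-n)`.

Since `A(0)` takes finitely many values, so does each product, and a pattern is a value of positive
probability. A product with no empty row or column, which irreducibility ensures, is of rank one if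
and only if it acts by a constant map; it suffices that it be constant on the classes of the vectors
of `(1/q)ℤ^k`, for a single `q` (`IsOfRank.exists_act_eq`, `isOfRank_one_of_act_eq`). The only use
of ergodicity or independence is the recurrence of products of positive probability in the past
(`isRecurrentModel`): by Poincaré recurrence and a zero-one law they recur in the future, and by
stationarity they occur in the past.

If a pattern of rank one exists, then almost surely `back n ω` is constant for large `n`; its value
`Z ω` is the stationary solution, and every other solution or initial condition has been forgotten
after `n` steps, which is strong coupling. Every stationary regime `Q` is carried by the graph of
`Z`, since `Q` is invariant under the `n`-th iterate of the skew product and this iterate maps to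
the graph outside an event whose probability tends to zero
(`IsStationaryRegime.eq_map_of_collapsed`).

Conversely, let `q` be a common denominator of the entries and `Λ` the set of classes of the vectors
of `(1/q)ℤ^k`. It is countable and invariant, and a product of finite projective diameter maps it to
a finite set. By recurrence the decreasing sets `back n ω '' Λ` stabilize to a random finite set of
almost surely constant cardinality (`exists_encard_attractor`), which `A(0)` therefore carries
bijectively from `ω` to `θ ω`, and its uniform law is a stationary regime
(`isStationaryRegime_attractorRegime`). The same holds for the lattice of mesh `1/(2q)`. If the
regime is unique, both constructions give the same one, so that some product maps the finer lattice
into the coarser one. Matrices do not expand distances, so neighbours in the finer lattice are sent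
to points at distance at most `1/(2q)`; two such points of the coarser lattice are equal. The
product is thus constant on the finer lattice, and is a pattern of rank one
(`HasUniqueStationaryRegime.exists_isPattern`).
-/

namespace MaxPlus

/-! ### Matrices without empty rows or columns -/

/-- Every row and every column has a finite entry. Irreducible matrices have this property and,
unlike irreducibility, it is inherited by products. -/
structure Proper {k : ℕ} (A : MaxMat k) : Prop where
  row : ∀ i, ∃ j, A i j ≠ ⊥
  col : ∀ j, ∃ i, A i j ≠ ⊥

theorem exists_coe_of_ne_bot {x : WithBot ℝ} (h : x ≠ ⊥) : ∃ a : ℝ, x = a := by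
  obtain ⟨a, ha⟩ := WithBot.ne_bot_iff_exists.1 h
  exact ⟨a, ha.symm⟩

/-- A finite entry of a product is the weight of a path of length two. -/
theorem exists_mul_entry {k : ℕ} {A B : MaxMat k} {i j : Fin k} {c : ℝ}
    (h : mul A B i j = c) : ∃ (l : Fin k) (a b : ℝ), A i l = a ∧ B l j = b ∧ c = a + b := by
  obtain ⟨l, -, hl⟩ := Finset.exists_mem_eq_sup Finset.univ ⟨i, Finset.mem_univ i⟩
    fun l => A i l + B l j
  have hs : A i l + B l j = c := hl.symm.trans h
  have hne : A i l + B l j ≠ ⊥ := by simp [hs]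
  rw [Ne, WithBot.add_eq_bot, not_or] at hne
  obtain ⟨a, ha⟩ := exists_coe_of_ne_bot hne.1
  obtain ⟨b, hb⟩ := exists_coe_of_ne_bot hne.2
  rw [ha, hb] at hs
  exact ⟨l, a, b, ha, hb, by exact_mod_cast hs.symm⟩

theorem exists_mul_entry_ge {k : ℕ} {A B : MaxMat k} {i j l : Fin k} {a b : ℝ}
    (ha : A i l = a) (hb : B l j = b) : ∃ c : ℝ, mul A B i j = c ∧ a + b ≤ c := by
  have hle : A i l + B l j ≤ mul A B i j :=
    Finset.le_sup (f := fun l => A i l + B l j) (Finset.mem_univ l)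
  rw [ha, hb] at hle
  have hne : mul A B i j ≠ ⊥ := by
    intro h
    rw [h, le_bot_iff] at hle
    simp [WithBot.add_eq_bot] at hle
  obtain ⟨c, hc⟩ := exists_coe_of_ne_bot hne
  rw [hc] at hle
  exact ⟨c, hc, by exact_mod_cast hle⟩

theorem col_ne_bot {k : ℕ} {A : MaxMat k} (hA : Irred A) (j : Fin k) : ∃ i, A i j ≠ ⊥ := by
  by_contra hc
  push Not at hc
  have key : ∀ n i, pow A (n + 1) i j = ⊥ := by
    intro n
    induction n with
    | zero =>
      intro i
      simp only [pow, mul, Finset.sup_eq_bot_iff]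
      intro l _
      by_cases h : l = j
      · simp [h, hc]
      · simp [one, h]
    | succ n ih =>
      intro i
      rw [pow, mul, Finset.sup_eq_bot_iff]
      intro l _
      simp [ih l]
  obtain ⟨n, hn, h⟩ := hA j j
  obtain ⟨m, rfl⟩ : ∃ m, n = m + 1 := ⟨n - 1, by omega⟩
  exact h (key m j)

theorem Irred.proper {k : ℕ} {A : MaxMat k} (hA : Irred A) : Proper A :=
  ⟨row_ne_bot hA, col_ne_bot hA⟩

theorem proper_one (k : ℕ) : Proper (one k) :=
  ⟨fun i => ⟨i, by simp [one]⟩, fun i => ⟨i, by simp [one]⟩⟩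

theorem Proper.mul {k : ℕ} {A B : MaxMat k} (hA : Proper A) (hB : Proper B) :
    Proper (mul A B) := by
  have key : ∀ i l j, A i l ≠ ⊥ → B l j ≠ ⊥ → MaxPlus.mul A B i j ≠ ⊥ := by
    intro i l j h h'
    obtain ⟨a, ha⟩ := exists_coe_of_ne_bot h
    obtain ⟨b, hb⟩ := exists_coe_of_ne_bot h'
    obtain ⟨c, hc, -⟩ := exists_mul_entry_ge ha hb
    simp [hc]
  constructor
  · intro i
    obtain ⟨l, hl⟩ := hA.row i
    obtain ⟨j, hj⟩ := hB.row l
    exact ⟨j, key i l j hl hj⟩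
  · intro j
    obtain ⟨l, hl⟩ := hB.col j
    obtain ⟨i, hi⟩ := hA.col l
    exact ⟨i, key i l j hi hl⟩

/-! ### The action on finite vectors and on projective space -/

theorem add_le_mulVec {k : ℕ} {A : MaxMat k} {i j : Fin k} {a : ℝ} (h : A i j = a)
    (u : Fin k → ℝ) : a + u j ≤ mulVec A u i := by
  have h1 := coe_mulVec (A := A) (i := i) ⟨j, by simp [h]⟩ u
  have h2 : A i j + (u j : WithBot ℝ) ≤ mulVec A u i := by
    rw [h1]
    exact Finset.le_sup (f := fun j => A i j + (u j : WithBot ℝ)) (Finset.mem_univ j)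
  rw [h] at h2
  exact_mod_cast h2

theorem exists_mulVec_eq {k : ℕ} {A : MaxMat k} {i : Fin k} (h : ∃ j, A i j ≠ ⊥)
    (u : Fin k → ℝ) : ∃ (j : Fin k) (a : ℝ), A i j = a ∧ mulVec A u i = a + u j := by
  have h1 := coe_mulVec h u
  obtain ⟨j, -, hj⟩ := Finset.exists_mem_eq_sup Finset.univ ⟨i, Finset.mem_univ i⟩
    fun j => A i j + (u j : WithBot ℝ)
  rw [hj] at h1
  have hne : A i j ≠ ⊥ := by
    intro hb
    simp [hb] at h1
  obtain ⟨a, ha⟩ := exists_coe_of_ne_bot hne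
  rw [ha] at h1
  exact ⟨j, a, ha, by exact_mod_cast h1⟩

theorem mulVec_mul {k : ℕ} {A B : MaxMat k} (hA : Proper A) (hB : Proper B) (u : Fin k → ℝ) :
    mulVec (mul A B) u = mulVec A (mulVec B u) := by
  funext i
  apply le_antisymm
  · obtain ⟨j, c, hc, h⟩ := exists_mulVec_eq ((hA.mul hB).row i) u
    obtain ⟨l, a, b, ha, hb, rfl⟩ := exists_mul_entry hc
    have h1 := add_le_mulVec ha (mulVec B u)
    have h2 := add_le_mulVec hb u
    linarith
  · obtain ⟨l, a, ha, h⟩ := exists_mulVec_eq (hA.row i) (mulVec B u)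
    obtain ⟨j, b, hb, h'⟩ := exists_mulVec_eq (hB.row l) u
    obtain ⟨c, hc, hle⟩ := exists_mul_entry_ge ha hb
    have h1 := add_le_mulVec hc u
    linarith

theorem mulVec_one {k : ℕ} (u : Fin k → ℝ) : mulVec (one k) u = u := by
  funext i
  obtain ⟨j, a, ha, h⟩ := exists_mulVec_eq ((proper_one k).row i) u
  by_cases hij : i = j
  · subst hij
    have ha' : (0 : WithBot ℝ) = a := by simpa [one] using ha
    have : (0 : ℝ) = a := by exact_mod_cast ha'
    linarith
  · simp [one, hij] at ha

theorem act_proj {k : ℕ} (A : MaxMat k) (u : Fin k → ℝ) : act A (proj u) = proj (mulVec A u) :=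
  rfl

theorem act_mul {k : ℕ} {A B : MaxMat k} (hA : Proper A) (hB : Proper B) (z : ProjSpace k) :
    act (mul A B) z = act A (act B z) := by
  induction z using Quotient.inductionOn with
  | h u => exact congrArg proj (mulVec_mul hA hB u)

theorem act_one {k : ℕ} (z : ProjSpace k) : act (one k) z = z := by
  induction z using Quotient.inductionOn with
  | h u => exact congrArg proj (mulVec_one u)

theorem exists_proj_eq {k : ℕ} (z : ProjSpace k) : ∃ u, proj u = z := Quotient.exists_rep z

theorem proj_eq_iff {k : ℕ} {u v : Fin k → ℝ} : proj u = proj v ↔ ∃ a : ℝ, ∀ i, u i = a + v i :=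
  Quotient.eq (r := projSetoid k)

theorem mulVec_mono {k : ℕ} {A : MaxMat k} (hA : Proper A) {u v : Fin k → ℝ}
    (h : ∀ i, u i ≤ v i) (i : Fin k) : mulVec A u i ≤ mulVec A v i := by
  obtain ⟨j, a, ha, h1⟩ := exists_mulVec_eq (hA.row i) u
  have := add_le_mulVec ha v
  linarith [h j]

/-! ### Rank one matrices act by constant maps -/

theorem IsOfRank.exists_act_eq {k : ℕ} [NeZero k] {A : MaxMat k} (hA : Proper A)
    (h : IsOfRank A 1) : ∃ c, ∀ z, act A z = c := by
  obtain ⟨J, hJ, -, hcol⟩ := h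
  obtain ⟨j, rfl⟩ := Finset.card_eq_one.1 hJ
  have hpar : ∀ i, ∃ a : ℝ, ∀ s, A s i = (a : WithBot ℝ) + A s j := by
    intro i
    by_cases hi : i = j
    · exact ⟨0, fun s => by simp [hi]⟩
    obtain ⟨α, a, ha⟩ := hcol i (by simpa using hi)
    simp only [Finset.sup_singleton] at ha
    obtain ⟨s₀, hs₀⟩ := hA.col i
    have hα : α j ≠ ⊥ := by
      intro hb
      exact hs₀ (by rw [ha, hb]; simp)
    obtain ⟨b, hb⟩ := exists_coe_of_ne_bot hα
    exact ⟨a + b, fun s => by rw [ha s, hb, WithBot.coe_add, add_assoc]⟩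
  choose a ha using hpar
  have hfin : ∀ s, ∃ m : ℝ, A s j = m := by
    intro s
    apply exists_coe_of_ne_bot
    intro hb
    obtain ⟨i, hi⟩ := hA.row s
    exact hi (by rw [ha, hb]; simp)
  choose m hm using hfin
  have hent : ∀ s i, A s i = ((a i + m s : ℝ) : WithBot ℝ) := by
    intro s i
    rw [ha, hm, WithBot.coe_add]
  refine ⟨proj m, fun z => ?_⟩
  obtain ⟨u, rfl⟩ := exists_proj_eq z
  rw [act_proj, proj_eq_iff]
  -- `mulVec A u s - m s = max_i (a i + u i)` does not depend on `s`.
  have hle : ∀ s t, mulVec A u s - m s ≤ mulVec A u t - m t := by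
    intro s t
    obtain ⟨l, b, hb, h⟩ := exists_mulVec_eq (hA.row s) u
    have h1 := add_le_mulVec (hent t l) u
    rw [hent] at hb
    have hb' : a l + m s = b := by exact_mod_cast hb
    linarith
  refine ⟨mulVec A u 0 - m 0, fun s => ?_⟩
  linarith [hle s 0, hle 0 s]

/-- The classes of the vectors with coordinates in `(1/q)ℤ`. -/
def lattice (k q : ℕ) : Set (ProjSpace k) :=
  Set.range fun v : Fin k → ℤ => proj fun i => (v i : ℝ) / q

theorem countable_lattice (k q : ℕ) : (lattice k q).Countable := Set.countable_range _

theorem lattice_nonempty (k q : ℕ) : (lattice k q).Nonempty := Set.range_nonempty _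

/-- A matrix that acts on a lattice by a constant map is of rank one: the image of a vector whose
`j`-th coordinate is much larger than the others is the class of the `j`-th column. -/
theorem isOfRank_one_of_act_eq {k : ℕ} [NeZero k] {A : MaxMat k} (hA : Proper A) {q : ℕ}
    (hq : 0 < q) {c : ProjSpace k} (h : ∀ z ∈ lattice k q, act A z = c) : IsOfRank A 1 := by
  have hq' : (q : ℝ) ≠ 0 := by positivity
  have hcol : ∀ j, ∃ b : ℝ, ∀ s, A s j = ((b + mulVec A 0 s : ℝ) : WithBot ℝ) := by
    intro j
    -- The images of `n • e_j` are all parallel to that of `0`.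
    have hd : ∀ n : ℕ, ∃ d : ℝ, ∀ s, mulVec A (fun i => if i = j then (n : ℝ) else 0) s =
        d + mulVec A 0 s := by
      intro n
      rw [← proj_eq_iff, ← act_proj, ← act_proj, h _ ⟨fun i => if i = j then n * q else 0, ?_⟩,
        h _ ⟨0, ?_⟩]
      · refine congrArg proj (funext fun i => ?_)
        simp
      · refine congrArg proj (funext fun i => ?_)
        by_cases hi : i = j <;> simp [hi, hq']
    choose d hd using hd
    have hoff : ∀ (n : ℕ) s l (a : ℝ), A s l = (a : WithBot ℝ) →
        mulVec A (fun i => if i = j then (n : ℝ) else 0) s = a + (if l = j then (n : ℝ) else 0) →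
        l ≠ j → mulVec A (fun i => if i = j then (n : ℝ) else 0) s ≤ mulVec A 0 s := by
      intro n s l a ha hl hlj
      have := add_le_mulVec ha 0
      simp only [hlj, if_false] at hl
      simpa [hl] using this
    obtain ⟨s₀, hs₀⟩ := hA.col j
    obtain ⟨a₀, ha₀⟩ := exists_coe_of_ne_bot hs₀
    have hlow : ∀ (n : ℕ) s (a : ℝ), A s j = (a : WithBot ℝ) → a + n ≤ d n + mulVec A 0 s := by
      intro n s a ha
      have := add_le_mulVec ha (fun i => if i = j then (n : ℝ) else 0)
      rw [hd] at this
      simpa using this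
    -- If `A s j = -∞`, then row `s` of the image stays bounded as `n` grows while row `s₀` does not.
    have hfin : ∀ s, ∃ a : ℝ, A s j = a := by
      intro s
      apply exists_coe_of_ne_bot
      intro hb
      obtain ⟨n, hn⟩ := exists_nat_gt (mulVec A 0 s₀ - a₀)
      obtain ⟨l, a, ha, hl⟩ := exists_mulVec_eq (hA.row s)
        (fun i => if i = j then (n : ℝ) else 0)
      have hlj : l ≠ j := by
        rintro rfl
        simp [hb] at ha
      have h1 := hoff n s l a ha hl hlj
      rw [hd] at h1
      linarith [hlow n s₀ a₀ ha₀]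
    choose a ha using hfin
    obtain ⟨n, hn⟩ : ∃ n : ℕ, ∀ s, mulVec A 0 s - a s ≤ n := by
      obtain ⟨M, hM⟩ := Set.finite_range (fun s => mulVec A 0 s - a s) |>.bddAbove
      obtain ⟨n, hn⟩ := exists_nat_ge M
      exact ⟨n, fun s => (hM ⟨s, rfl⟩).trans hn⟩
    refine ⟨d n - n, fun s => ?_⟩
    have hle : d n + mulVec A 0 s ≤ a s + n := by
      obtain ⟨l, b, hb, hl⟩ := exists_mulVec_eq (hA.row s)
        (fun i => if i = j then (n : ℝ) else 0)
      by_cases hlj : l = j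
      · subst hlj
        have hab : a s = b := by
          rw [ha] at hb
          exact_mod_cast hb
        rw [hd] at hl
        simp only [if_true] at hl
        linarith
      · have h1 := hoff n s l b hb hl hlj
        rw [hd] at h1
        linarith [hn s]
    rw [ha]
    have : a s = d n - n + mulVec A 0 s := by linarith [hlow n s (a s) (ha s)]
    exact_mod_cast this
  choose b hb using hcol
  refine ⟨{0}, rfl, ?_, ?_⟩
  · intro i hi j hj hij
    simp only [Finset.mem_singleton] at hi hj
    exact absurd (hi.trans hj.symm) hij
  · intro i _
    refine ⟨fun _ => 0, b i - b 0, fun s => ?_⟩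
    simp only [Finset.sup_singleton, zero_add]
    rw [hb i s, hb 0 s, ← WithBot.coe_add]
    congr 1
    ring

/-! ### Lattices and rational matrices -/

/-- All entries are in `(1/q)ℤ ∪ {-∞}`. -/
def HasEntriesIn {k : ℕ} (q : ℕ) (A : MaxMat k) : Prop :=
  ∀ i j, A i j = ⊥ ∨ ∃ n : ℤ, A i j = ((n / q : ℝ) : WithBot ℝ)

theorem HasEntriesIn.mul_left {k q : ℕ} {A : MaxMat k} (h : HasEntriesIn q A) {m : ℕ}
    (hm : 0 < m) : HasEntriesIn (m * q) A := by
  intro i j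
  refine (h i j).imp_right ?_
  rintro ⟨n, hn⟩
  refine ⟨m * n, ?_⟩
  rw [hn]
  have : (m : ℝ) ≠ 0 := by positivity
  push_cast
  rw [mul_div_mul_left _ _ this]

theorem HasRationalEntries.exists_hasEntriesIn {k : ℕ} {A : MaxMat k}
    (h : HasRationalEntries A) : ∃ q : ℕ, 0 < q ∧ HasEntriesIn q A := by
  have h' : ∀ i j, ∃ x : ℚ, A i j = ⊥ ∨ A i j = ((x : ℝ) : WithBot ℝ) := by
    intro i j
    rcases h i j with hb | ⟨x, hx⟩
    · exact ⟨0, Or.inl hb⟩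
    · exact ⟨x, Or.inr hx⟩
  choose x hx using h'
  refine ⟨∏ i, ∏ j, (x i j).den, Finset.prod_pos fun i _ => Finset.prod_pos fun j _ => (x i j).pos,
    fun i j => (hx i j).imp_right fun hij => ?_⟩
  obtain ⟨m, hm⟩ : (x i j).den ∣ ∏ i, ∏ j, (x i j).den :=
    (Finset.dvd_prod_of_mem (fun j => (x i j).den) (Finset.mem_univ j)).trans
      (Finset.dvd_prod_of_mem (fun i => ∏ j, (x i j).den) (Finset.mem_univ i))
  have hpos : 0 < ∏ i, ∏ j, (x i j).den :=
    Finset.prod_pos fun i _ => Finset.prod_pos fun j _ => (x i j).pos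
  rw [hm] at hpos ⊢
  have hm0 : (m : ℝ) ≠ 0 := by
    have := Nat.pos_of_mul_pos_left hpos
    positivity
  refine ⟨(x i j).num * m, ?_⟩
  rw [hij]
  push_cast
  rw [mul_div_mul_right _ _ hm0]
  congr 1
  exact Rat.cast_def _

theorem exists_common_hasEntriesIn {k : ℕ} {S : Set (MaxMat k)} (hS : S.Finite)
    (h : ∀ A ∈ S, HasRationalEntries A) : ∃ q : ℕ, 0 < q ∧ ∀ A ∈ S, HasEntriesIn q A := by
  induction S, hS using Set.Finite.induction_on with
  | empty => exact ⟨1, one_pos, by simp⟩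
  | @insert B S _ _ ih =>
    obtain ⟨q, hq, hS⟩ := ih fun A hA => h A (Set.mem_insert_of_mem _ hA)
    obtain ⟨m, hm, hB⟩ := (h B (Set.mem_insert _ _)).exists_hasEntriesIn
    refine ⟨m * q, Nat.mul_pos hm hq, ?_⟩
    rintro A (rfl | hA)
    · rw [mul_comm]
      exact hB.mul_left hq
    · exact (hS A hA).mul_left hm

theorem HasEntriesIn.act_mem_lattice {k q : ℕ} {A : MaxMat k} (h : HasEntriesIn q A)
    (hA : Proper A) {z : ProjSpace k} (hz : z ∈ lattice k q) : act A z ∈ lattice k q := by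
  obtain ⟨v, rfl⟩ := hz
  have : ∀ i, ∃ n : ℤ, mulVec A (fun i => (v i : ℝ) / q) i = (n : ℝ) / q := by
    intro i
    obtain ⟨j, a, ha, hj⟩ := exists_mulVec_eq (hA.row i) (fun i => (v i : ℝ) / q)
    rcases h i j with hb | ⟨n, hn⟩
    · simp [hb] at ha
    · rw [ha] at hn
      have hn' : a = n / q := by exact_mod_cast hn
      refine ⟨n + v j, ?_⟩
      rw [hj, hn']
      push_cast
      ring
  choose n hn using this
  exact ⟨n, by rw [act_proj]; exact congrArg proj (funext fun i => (hn i).symm)⟩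

/-- Two points of the lattice that have representatives at distance less than `1/q` coincide. -/
theorem proj_eq_of_mem_lattice {k q : ℕ} [NeZero k] (hq : 0 < q) {u v : Fin k → ℝ}
    (hu : proj u ∈ lattice k q) (hv : proj v ∈ lattice k q) (h0 : ∀ i, 0 ≤ v i - u i)
    (h1 : ∀ i, v i - u i < 1 / q) : proj u = proj v := by
  obtain ⟨x, hx⟩ := hu
  obtain ⟨y, hy⟩ := hv
  obtain ⟨a, ha⟩ := proj_eq_iff.1 hx.symm
  obtain ⟨b, hb⟩ := proj_eq_iff.1 hy.symm
  have hq' : (0 : ℝ) < q := by positivity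
  have hint : ∀ s, y s - x s = y 0 - x 0 := by
    intro s
    have key : |(((y s - x s) - (y 0 - x 0) : ℤ) : ℝ)| < 1 := by
      have e : (((y s - x s) - (y 0 - x 0) : ℤ) : ℝ) =
          q * ((v s - u s) - (v 0 - u 0)) := by
        rw [ha, hb, ha, hb]
        push_cast
        field_simp
        ring
      rw [e, abs_mul, abs_of_pos hq', ← lt_div_iff₀' hq', abs_lt]
      constructor <;> linarith [h0 s, h0 0, h1 s, h1 0]
    have : |(y s - x s) - (y 0 - x 0)| < 1 := by exact_mod_cast key
    rw [Int.abs_lt_one_iff] at this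
    linarith
  rw [proj_eq_iff]
  refine ⟨a - b - (y 0 - x 0 : ℤ) / q, fun s => ?_⟩
  rw [ha, hb, ← hint s]
  push_cast
  field_simp
  ring

/-- A matrix that maps the finer lattice into the coarser one is constant on the finer lattice:
moving one coordinate by `1/(2q)` moves the image by at most `1/(2q)`, which is less than the
distance between two points of the coarser lattice. -/
theorem exists_act_eq_of_mapsTo_lattice {k q : ℕ} [NeZero k] (hq : 0 < q) {A : MaxMat k}
    (hA : Proper A) (h : ∀ z ∈ lattice k (2 * q), act A z ∈ lattice k q) :
    ∃ c, ∀ z ∈ lattice k (2 * q), act A z = c := by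
  -- `H` is the group of periods of the action; it contains the unit vectors.
  let f : (Fin k → ℤ) → ProjSpace k := fun v => act A (proj fun i => (v i : ℝ) / (2 * q : ℕ))
  let H : AddSubgroup (Fin k → ℤ) :=
    { carrier := {d | ∀ v, f (v + d) = f v}
      zero_mem' := fun v => by rw [add_zero]
      add_mem' := fun {d e} hd he v => by rw [← add_assoc, he, hd]
      neg_mem' := fun {d} hd v => by rw [← hd (v + -d), neg_add_cancel_right] }
  have hq' : (0 : ℝ) < q := by positivity
  have hstep : ∀ i : Fin k, (Pi.single i 1 : Fin k → ℤ) ∈ H := by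
    intro i v
    symm
    have hd0 : ∀ j, (0 : ℝ) ≤ (Pi.single i 1 : Fin k → ℤ) j / (2 * q : ℕ) := by
      intro j
      by_cases hj : j = i
      · subst hj
        simp
      · simp [hj]
    have hd1 : ∀ j, ((Pi.single i 1 : Fin k → ℤ) j : ℝ) / (2 * q : ℕ) ≤ 1 / (2 * q : ℕ) := by
      intro j
      by_cases hj : j = i
      · subst hj
        simp
      · simp [hj]
    refine proj_eq_of_mem_lattice hq (h _ ⟨v, rfl⟩) (h _ ⟨v + Pi.single i 1, rfl⟩) ?_ ?_
    · intro s
      rw [sub_nonneg]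
      refine mulVec_mono hA (fun j => ?_) s
      have := hd0 j
      simp only [Pi.add_apply, Int.cast_add, add_div]
      linarith
    · intro s
      have h1 : mulVec A (fun j => (((v + Pi.single i 1 : Fin k → ℤ) j : ℤ) : ℝ) / (2 * q : ℕ)) s ≤
          1 / (2 * q : ℕ) + mulVec A (fun j => (v j : ℝ) / (2 * q : ℕ)) s := by
        rw [← mulVec_shift A (u := fun j => 1 / (2 * q : ℕ) + (v j : ℝ) / (2 * q : ℕ))
          fun j => rfl]
        refine mulVec_mono hA (fun j => ?_) s
        have := hd1 j
        simp only [Pi.add_apply, Int.cast_add, add_div]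
        linarith
      have h2 : (1 : ℝ) / (2 * q : ℕ) < 1 / q := by
        push_cast
        exact one_div_lt_one_div_of_lt hq' (by linarith)
      linarith
  have htop : ∀ d, d ∈ H := by
    intro d
    rw [← Finset.univ_sum_single d]
    refine H.sum_mem fun i _ => ?_
    have : (Pi.single i (d i) : Fin k → ℤ) = d i • Pi.single i 1 := by
      rw [← Pi.single_smul]
      simp
    rw [this]
    exact H.zsmul_mem (hstep i) _
  refine ⟨f 0, ?_⟩
  rintro _ ⟨v, rfl⟩
  have := htop v 0
  rwa [zero_add] at this

/-- A point of the image is determined by the differences of its coordinates with the `0`-th one,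
which are bounded by the projective diameter and lie in `(1/q)ℤ`. -/
theorem finite_act_image_lattice {k q : ℕ} [NeZero k] (hq : 0 < q) {A : MaxMat k}
    (hD : projDiam A < ⊤) (h : ∀ z ∈ lattice k q, act A z ∈ lattice k q) :
    (act A '' lattice k q).Finite := by
  have hq' : (0 : ℝ) < q := by positivity
  set m := mulVec A 0
  have hdist : ∀ u i, |(mulVec A u i - mulVec A u 0) - (m i - m 0)| ≤ (projDiam A).toReal := by
    have h1 : ∀ u v i j, (mulVec A u i - mulVec A v i) + (mulVec A v j - mulVec A u j) ≤
        (projDiam A).toReal := by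
      intro u v i j
      have hle : ENNReal.ofReal (projDist (mulVec A u) (mulVec A v)) ≤ projDiam A :=
        le_iSup₂ (f := fun u v => ENNReal.ofReal (projDist (mulVec A u) (mulVec A v))) u v
      have h2 := (ENNReal.ofReal_le_iff_le_toReal hD.ne).1 hle
      refine le_trans (add_le_add ?_ ?_) h2
      · exact le_ciSup (f := fun i => mulVec A u i - mulVec A v i)
          (Set.finite_range _).bddAbove i
      · exact le_ciSup (f := fun i => mulVec A v i - mulVec A u i)
          (Set.finite_range _).bddAbove j
    intro u i
    rw [abs_le]
    constructor <;> linarith [h1 u 0 i 0, h1 u 0 0 i]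
  obtain ⟨K, hK⟩ : ∃ K : ℤ, ∀ i, q * ((projDiam A).toReal + |m i - m 0|) ≤ K := by
    obtain ⟨b, hb⟩ :=
      (Set.finite_range fun i => q * ((projDiam A).toReal + |m i - m 0|)).bddAbove
    obtain ⟨n, hn⟩ := exists_nat_ge b
    exact ⟨n, fun i => (hb ⟨i, rfl⟩).trans (by exact_mod_cast hn)⟩
  refine ((Set.finite_Icc (fun _ => -K : Fin k → ℤ) fun _ => K).image
    fun w => proj fun i => (w i : ℝ) / q).subset ?_
  rintro _ ⟨z, hz, rfl⟩
  obtain ⟨y, hy⟩ := h z hz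
  obtain ⟨u, rfl⟩ := exists_proj_eq z
  rw [act_proj] at hy ⊢
  obtain ⟨a, ha⟩ := proj_eq_iff.1 hy.symm
  refine ⟨fun i => y i - y 0, ?_, ?_⟩
  · have hb : ∀ i, |y i - y 0| ≤ K := by
      intro i
      have e : ((y i - y 0 : ℤ) : ℝ) = q * (mulVec A u i - mulVec A u 0) := by
        rw [ha, ha]
        push_cast
        field_simp
        ring
      have : |((y i - y 0 : ℤ) : ℝ)| ≤ K := by
        rw [e, abs_mul, abs_of_pos hq']
        refine le_trans (mul_le_mul_of_nonneg_left ?_ hq'.le) (hK i)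
        have h3 := abs_sub_abs_le_abs_sub (mulVec A u i - mulVec A u 0) (m i - m 0)
        linarith [hdist u i]
      exact_mod_cast this
    exact ⟨fun i => (abs_le.1 (hb i)).1, fun i => (abs_le.1 (hb i)).2⟩
  · rw [proj_eq_iff]
    refine ⟨-a - y 0 / q, fun i => ?_⟩
    rw [ha]
    push_cast
    ring

/-! ### Products along orbits -/

theorem iterate_iterate_symm {Ω : Type*} [MeasurableSpace Ω] (θ : Ω ≃ᵐ Ω) (n l : ℕ) (ω : Ω) :
    θ^[l] (θ.symm^[n + l] ω) = θ.symm^[n] ω := by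
  rw [add_comm, Function.iterate_add_apply]
  exact Function.LeftInverse.iterate θ.apply_symm_apply l _

section Orbits

variable {Ω : Type*} [MeasurableSpace Ω] {k : ℕ} {θ : Ω ≃ᵐ Ω} {A : Ω → MaxMat k}

theorem proper_matProd (hA : ∀ ω, Proper (A ω)) (n : ℕ) (ω : Ω) :
    Proper (matProd θ A n ω) := by
  induction n with
  | zero => exact proper_one k
  | succ n ih => exact (hA _).mul ih

theorem act_matProd_succ (hA : ∀ ω, Proper (A ω)) (n : ℕ) (ω : Ω) (z : ProjSpace k) :
    act (matProd θ A (n + 1) ω) z = act (A (θ^[n] ω)) (act (matProd θ A n ω) z) :=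
  act_mul (hA _) (proper_matProd hA n ω) z

theorem act_matProd_add (hA : ∀ ω, Proper (A ω)) (n m : ℕ) (ω : Ω) (z : ProjSpace k) :
    act (matProd θ A (n + m) ω) z =
      act (matProd θ A n (θ^[m] ω)) (act (matProd θ A m ω) z) := by
  induction n with
  | zero => rw [zero_add]; exact (act_one _).symm
  | succ n ih =>
    rw [add_right_comm, act_matProd_succ hA, act_matProd_succ hA, ih, Function.iterate_add_apply]

theorem proj_state (hA : ∀ ω, Proper (A ω)) (x₀ : Ω → Fin k → ℝ) (n : ℕ) (ω : Ω) :
    proj (state θ A x₀ n ω) = act (matProd θ A n ω) (proj (x₀ ω)) := by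
  induction n with
  | zero => exact (act_one _).symm
  | succ n ih => rw [act_matProd_succ hA, ← ih]; rfl

theorem act_matProd_mem (hA : ∀ ω, Proper (A ω)) {Λ : Set (ProjSpace k)}
    (hΛ : ∀ ω, ∀ z ∈ Λ, act (A ω) z ∈ Λ) (n : ℕ) (ω : Ω) {z : ProjSpace k} (hz : z ∈ Λ) :
    act (matProd θ A n ω) z ∈ Λ := by
  induction n with
  | zero => exact (act_one z).symm ▸ hz
  | succ n ih => rw [act_matProd_succ hA]; exact hΛ _ _ ih

/-- The action of the past: `back θ A n ω` is the map of `A(-1) ⊗ ⋯ ⊗ A(-n)`, so that products are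
extended on the right as `n` grows. -/
noncomputable def back (θ : Ω ≃ᵐ Ω) (A : Ω → MaxMat k) (n : ℕ) (ω : Ω) :
    ProjSpace k → ProjSpace k :=
  act (matProd θ A n (θ.symm^[n] ω))

theorem back_add (hA : ∀ ω, Proper (A ω)) (n l : ℕ) (ω : Ω) (z : ProjSpace k) :
    back θ A (n + l) ω z = back θ A n ω (act (matProd θ A l (θ.symm^[n + l] ω)) z) := by
  rw [back, act_matProd_add hA, iterate_iterate_symm]
  rfl

theorem back_succ_apply (hA : ∀ ω, Proper (A ω)) (n : ℕ) (ω : Ω) (z : ProjSpace k) :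
    back θ A (n + 1) (θ ω) z = act (A ω) (back θ A n ω z) := by
  have h := iterate_iterate_symm θ 0 n ω
  rw [zero_add] at h
  rw [back, act_matProd_succ hA, Function.iterate_succ_apply, θ.symm_apply_apply, h]
  rfl

end Orbits

/-! ### Measurability -/

/-- The product `B (n-1) ⊗ ⋯ ⊗ B 0`. -/
noncomputable def seqProd {k : ℕ} (B : ℕ → MaxMat k) : ℕ → MaxMat k
  | 0 => one k
  | n + 1 => mul (B n) (seqProd B n)

theorem matProd_iterate {Ω : Type*} [MeasurableSpace Ω] {k : ℕ} (θ : Ω ≃ᵐ Ω) (A : Ω → MaxMat k)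
    (n N : ℕ) (ω : Ω) :
    matProd θ A N (θ^[n] ω) = seqProd (fun i => matSeq θ A (i + n) ω) N := by
  induction N with
  | zero => rfl
  | succ N ih =>
    rw [matProd, seqProd, ih, matSeq, matSeq, Function.iterate_add_apply]

theorem exists_simpleFunc_seqProd {Ω : Type*} [MeasurableSpace Ω] {k : ℕ}
    {B : ℕ → Ω → MaxMat k} (hfin : ∀ i, (Set.range (B i)).Finite)
    (h : ∀ i C, MeasurableSet (B i ⁻¹' {C})) (N : ℕ) :
    ∃ f : SimpleFunc Ω (MaxMat k), ∀ ω, f ω = seqProd (fun i => B i ω) N := by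
  induction N with
  | zero => exact ⟨SimpleFunc.const _ (one k), fun ω => rfl⟩
  | succ N ih =>
    obtain ⟨f, hf⟩ := ih
    refine ⟨((SimpleFunc.mk (B N) (h N) (hfin N)).pair f).map fun p => mul p.1 p.2,
      fun ω => ?_⟩
    change mul (B N ω) (f ω) = _
    rw [hf]
    rfl

/-- The event that a product of `N` consecutive matrices lies in `T` infinitely often depends only
on the matrices from any given index on. -/
theorem measurableSet_frequently_seqProd {Ω : Type*} [MeasurableSpace Ω] {k : ℕ}
    {B : ℕ → Ω → MaxMat k} (hfin : ∀ i, (Set.range (B i)).Finite) (a : ℕ)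
    (h : ∀ i ≥ a, ∀ C, MeasurableSet (B i ⁻¹' {C})) (N : ℕ) (T : Set (MaxMat k)) :
    MeasurableSet {ω | ∃ᶠ n in Filter.atTop, seqProd (fun i => B (i + n) ω) N ∈ T} := by
  have : {ω | ∃ᶠ n in Filter.atTop, seqProd (fun i => B (i + n) ω) N ∈ T} =
      ⋂ b : ℕ, ⋃ n : ℕ, {ω | seqProd (fun i => B (i + (n + (b + a))) ω) N ∈ T} := by
    ext ω
    simp only [Filter.frequently_atTop, Set.mem_ofPred_eq, Set.mem_iInter, Set.mem_iUnion]
    constructor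
    · intro h b
      obtain ⟨n, hn, hT⟩ := h (b + a)
      exact ⟨n - (b + a), by rwa [Nat.sub_add_cancel hn]⟩
    · intro h b
      obtain ⟨n, hn⟩ := h b
      exact ⟨n + (b + a), by omega, hn⟩
  rw [this]
  refine MeasurableSet.iInter fun b => MeasurableSet.iUnion fun n => ?_
  obtain ⟨f, hf⟩ := exists_simpleFunc_seqProd (B := fun i => B (i + (n + (b + a))))
    (fun i => hfin _) (fun i => h _ (by omega)) N
  convert f.measurableSet_preimage T using 1
  ext ω
  simp [hf]

theorem finite_range_matSeq {Ω : Type*} [MeasurableSpace Ω] {k : ℕ} {θ : Ω ≃ᵐ Ω}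
    {A : Ω → MaxMat k} (hfin : (Set.range A).Finite) (i : ℕ) :
    (Set.range (matSeq θ A i)).Finite :=
  hfin.subset (by rintro _ ⟨ω, rfl⟩; exact ⟨_, rfl⟩)

theorem measurableSet_matSeq {Ω : Type*} [MeasurableSpace Ω] {k : ℕ} {θ : Ω ≃ᵐ Ω}
    {A : Ω → MaxMat k} (hmeas : ∀ C, MeasurableSet (A ⁻¹' {C})) (i : ℕ) (C : MaxMat k) :
    MeasurableSet (matSeq θ A i ⁻¹' {C}) :=
  (θ.measurable.iterate i) (hmeas C)

theorem exists_simpleFunc_matProd {Ω : Type*} [MeasurableSpace Ω] {k : ℕ} {θ : Ω ≃ᵐ Ω}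
    {A : Ω → MaxMat k} (hfin : (Set.range A).Finite) (hmeas : ∀ C, MeasurableSet (A ⁻¹' {C}))
    (N : ℕ) : ∃ f : SimpleFunc Ω (MaxMat k), ∀ ω, f ω = matProd θ A N ω := by
  obtain ⟨f, hf⟩ := exists_simpleFunc_seqProd (finite_range_matSeq (θ := θ) hfin)
    (measurableSet_matSeq hmeas) N
  exact ⟨f, fun ω => (hf ω).trans (matProd_iterate θ A 0 N ω).symm⟩

theorem measurableSet_matProd {Ω : Type*} [MeasurableSpace Ω] {k : ℕ} {θ : Ω ≃ᵐ Ω}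
    {A : Ω → MaxMat k} (hfin : (Set.range A).Finite) (hmeas : ∀ C, MeasurableSet (A ⁻¹' {C}))
    (N : ℕ) (T : Set (MaxMat k)) : MeasurableSet {ω | matProd θ A N ω ∈ T} := by
  obtain ⟨f, hf⟩ := exists_simpleFunc_matProd (θ := θ) hfin hmeas N
  convert f.measurableSet_preimage T using 1
  ext ω
  simp [hf]

theorem finite_range_matProd {Ω : Type*} [MeasurableSpace Ω] {k : ℕ} {θ : Ω ≃ᵐ Ω}
    {A : Ω → MaxMat k} (hfin : (Set.range A).Finite) (hmeas : ∀ C, MeasurableSet (A ⁻¹' {C}))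
    (N : ℕ) : (Set.range (matProd θ A N)).Finite := by
  obtain ⟨f, hf⟩ := exists_simpleFunc_matProd (θ := θ) hfin hmeas N
  refine f.finite_range.subset ?_
  rintro _ ⟨ω, rfl⟩
  exact ⟨ω, hf ω⟩

theorem measurable_proj {k : ℕ} : Measurable (proj : (Fin k → ℝ) → ProjSpace k) :=
  measurable_quotient_mk''

theorem continuous_mulVec {k : ℕ} {A : MaxMat k} (hA : Proper A) : Continuous (mulVec A) := by
  have hle : ∀ u v i, mulVec A u i ≤ dist u v + mulVec A v i := by
    intro u v i
    rw [← mulVec_shift A (u := fun i => dist u v + v i) fun i => rfl]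
    refine mulVec_mono hA (fun j => ?_) i
    have h1 := dist_le_pi_dist u v j
    rw [Real.dist_eq] at h1
    linarith [le_abs_self (u j - v j)]
  refine (LipschitzWith.of_dist_le_mul (K := 1) fun u v => ?_).continuous
  rw [NNReal.coe_one, one_mul, dist_pi_le_iff dist_nonneg]
  intro i
  rw [Real.dist_eq, abs_sub_le_iff]
  have h1 := hle u v i
  have h2 := hle v u i
  rw [dist_comm] at h2
  constructor <;> linarith

theorem measurable_act {k : ℕ} {A : MaxMat k} (hA : Proper A) : Measurable (act A) :=
  measurable_from_quotient.2 (measurable_proj.comp (continuous_mulVec hA).measurable)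

instance instMeasurableSingletonClassProjSpace {k : ℕ} :
    MeasurableSingletonClass (ProjSpace k) where
  measurableSet_singleton z := by
    rw [measurableSet_quotient]
    obtain ⟨v, rfl⟩ := exists_proj_eq z
    have : (Quotient.mk'' ⁻¹' {proj v} : Set (Fin k → ℝ)) =
        ⋂ i, ⋂ j, {u | u i - u j = v i - v j} := by
      ext u
      simp only [Set.mem_preimage, Set.mem_singleton_iff, Set.mem_iInter, Set.mem_ofPred_eq]
      change proj u = proj v ↔ _
      rw [proj_eq_iff]
      constructor
      · rintro ⟨a, ha⟩ i j
        rw [ha, ha]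
        ring
      · intro h
        rcases isEmpty_or_nonempty (Fin k) with hk | ⟨⟨i₀⟩⟩
        · exact ⟨0, fun i => isEmptyElim i⟩
        · exact ⟨u i₀ - v i₀, fun i => by linarith [h i i₀]⟩
    rw [this]
    refine MeasurableSet.iInter fun i => MeasurableSet.iInter fun j => ?_
    exact measurableSet_eq_fun ((measurable_pi_apply i).sub (measurable_pi_apply j))
      measurable_const

/-! ### Recurrence of products -/

/-- The transformation preserves the measure, the matrix takes finitely many values, each of them
without empty rows or columns, and every set of products that has positive probability is almost
surely met in the past. The last condition is what ergodicity and independence have in common. -/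
structure IsRecurrentModel {Ω : Type*} [MeasurableSpace Ω] {k : ℕ} (P : Measure Ω)
    (θ : Ω ≃ᵐ Ω) (A : Ω → MaxMat k) : Prop where
  measurePreserving : MeasurePreserving θ P P
  finite_range : (Set.range A).Finite
  measurableSet_fiber : ∀ C, MeasurableSet (A ⁻¹' {C})
  proper : ∀ ω, Proper (A ω)
  ae_exists : ∀ (N : ℕ) (T : Set (MaxMat k)), 0 < P {ω | matProd θ A N ω ∈ T} →
    ∀ᵐ ω ∂P, ∃ n : ℕ, matProd θ A N (θ.symm^[n + N] ω) ∈ T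

/-- In the independent case the event that a product recurs infinitely often in the future is a
tail event of the sequence of matrices, and in the ergodic case it is invariant. -/
theorem prob_frequently_matProd_eq_zero_or_one {Ω : Type*} [MeasurableSpace Ω] {P : Measure Ω}
    [IsProbabilityMeasure P] {θ : Ω ≃ᵐ Ω} {k : ℕ} {A : Ω → MaxMat k}
    (hfin : (Set.range A).Finite) (hmeas : ∀ C, MeasurableSet (A ⁻¹' {C}))
    (hlaw : iIndepFun (m := fun _ : ℕ => (⊤ : MeasurableSpace (MaxMat k))) (matSeq θ A) P ∨
      Ergodic θ P) (N : ℕ) (T : Set (MaxMat k)) :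
    P {ω | ∃ᶠ n in Filter.atTop, matProd θ A N (θ^[n] ω) ∈ T} = 0 ∨
      P {ω | ∃ᶠ n in Filter.atTop, matProd θ A N (θ^[n] ω) ∈ T} = 1 := by
  simp only [matProd_iterate]
  rcases hlaw with hind | herg
  · rw [iIndepFun_iff_iIndep] at hind
    refine measure_zero_or_one_of_measurableSet_limsup_atTop (fun n => ?_) hind ?_
    · rintro _ ⟨S, -, rfl⟩
      exact (SimpleFunc.mk (matSeq θ A n) (measurableSet_matSeq hmeas n)
        (finite_range_matSeq hfin n)).measurableSet_preimage S
    · rw [Filter.limsup_eq_iInf_iSup_of_nat, MeasurableSpace.measurableSet_iInf]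
      intro a
      refine @measurableSet_frequently_seqProd _ (_) _ _ (finite_range_matSeq hfin) a
        (fun i hi C => ?_) N T
      refine (le_iSup₂_of_le (f := fun (i : ℕ) (_ : i ≥ a) =>
        MeasurableSpace.comap (matSeq θ A i) ⊤) i hi le_rfl) _ ?_
      exact ⟨{C}, trivial, rfl⟩
  · refine herg.toPreErgodic.prob_eq_zero_or_one (measurableSet_frequently_seqProd
      (finite_range_matSeq hfin) 0 (fun i _ => measurableSet_matSeq hmeas i) N T) ?_
    ext ω
    simp only [Set.mem_preimage, Set.mem_ofPred_eq, ← matProd_iterate,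
      ← Function.iterate_succ_apply]
    constructor
    · intro h
      exact (Filter.tendsto_add_atTop_nat 1).frequently h
    · intro h
      rw [Filter.frequently_atTop] at h ⊢
      intro a
      obtain ⟨b, hb, hT⟩ := h (a + 1)
      exact ⟨b - 1, by omega, by rwa [Nat.succ_eq_add_one, Nat.sub_add_cancel (by omega)]⟩

/-- Poincaré recurrence gives positive probability to infinitely many occurrences in the future, and
the zero-one law then gives them probability one. -/
theorem isRecurrentModel {Ω : Type*} [MeasurableSpace Ω] {P : Measure Ω}
    [IsProbabilityMeasure P] {θ : Ω ≃ᵐ Ω} (hθ : MeasurePreserving θ P P) {k : ℕ}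
    {A : Ω → MaxMat k} (hfin : (Set.range A).Finite) (hmeas : ∀ C, MeasurableSet (A ⁻¹' {C}))
    (hA : ∀ ω, Proper (A ω))
    (hlaw : iIndepFun (m := fun _ : ℕ => (⊤ : MeasurableSpace (MaxMat k))) (matSeq θ A) P ∨
      Ergodic θ P) : IsRecurrentModel P θ A := by
  refine ⟨hθ, hfin, hmeas, hA, fun N T hT => ?_⟩
  set E := {ω | matProd θ A N ω ∈ T}
  have hE : MeasurableSet E := measurableSet_matProd hfin hmeas N T
  have hfreq : ∀ᵐ ω ∂P, ∃ᶠ n in Filter.atTop, θ^[n] ω ∈ E := by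
    have hcons := hθ.conservative.ae_mem_imp_frequently_image_mem hE.nullMeasurableSet
    rcases prob_frequently_matProd_eq_zero_or_one hfin hmeas hlaw N T with h | h
    · refine absurd (measure_mono_null_ae ?_ h) hT.ne'
      exact hcons
    · have hns : NullMeasurableSet {ω | ∃ᶠ n in Filter.atTop, θ^[n] ω ∈ E} P := by
        refine MeasurableSet.nullMeasurableSet ?_
        simp only [Filter.frequently_atTop]
        have : {ω | ∀ a, ∃ b ≥ a, θ^[b] ω ∈ E} = ⋂ a : ℕ, ⋃ b : ℕ, ⋃ _ : b ≥ a, θ^[b] ⁻¹' E := by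
          ext ω
          simp
        rw [this]
        exact MeasurableSet.iInter fun a => MeasurableSet.iUnion fun b =>
          MeasurableSet.iUnion fun _ => θ.measurable.iterate b hE
      exact (prob_compl_eq_zero_iff₀ hns).2 h
  -- No occurrence in the whole past is less likely than no occurrence in a window of length `m`,
  -- whose probability does not depend on where the window is placed.
  set F : ℕ → Set Ω := fun m => ⋂ n : ℕ, ⋂ _ : n ≤ m, (θ^[n] ⁻¹' E)ᶜ
  have hF : ∀ m, MeasurableSet (F m) := fun m => MeasurableSet.iInter fun n =>
    MeasurableSet.iInter fun _ => (θ.measurable.iterate n hE).compl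
  have hanti : Antitone F := by
    intro a b hab ω hω
    simp only [F, Set.mem_iInter] at hω ⊢
    exact fun n hn => hω n (hn.trans hab)
  have hlim := tendsto_measure_iInter_atTop (μ := P) (fun m => (hF m).nullMeasurableSet) hanti
    ⟨0, measure_ne_top _ _⟩
  have hzero : P (⋂ m, F m) = 0 := by
    refine measure_mono_null ?_ (ae_iff.1 hfreq)
    intro ω hω hfr
    obtain ⟨n, hn⟩ := hfr.exists
    simp only [F, Set.mem_iInter] at hω
    exact hω n n le_rfl hn
  rw [hzero] at hlim
  rw [ae_iff]
  refine le_antisymm (ge_of_tendsto' hlim fun m => ?_) zero_le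
  have hmp : MeasurePreserving θ.symm^[m + N] P P := (hθ.symm θ).iterate _
  change _ ≤ P (F m)
  rw [← hmp.measure_preimage (hF m).nullMeasurableSet]
  refine measure_mono fun ω hω => ?_
  simp only [F, Set.mem_preimage, Set.mem_iInter]
  intro n hn hmem
  refine hω ⟨m - n, ?_⟩
  have h := iterate_iterate_symm θ (m - n + N) n ω
  rw [show m - n + N + n = m + N by omega] at h
  rw [Set.mem_preimage, h] at hmem
  exact hmem

section Regimes

variable {Ω : Type*} [MeasurableSpace Ω] {P : Measure Ω} {k : ℕ}
  {θ : Ω ≃ᵐ Ω} {A : Ω → MaxMat k}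

/-! ### Stationary regimes and the skew product -/

/-- The skew product `(ω, z) ↦ (θ ω, π(A(0, ω)) z)`. -/
noncomputable def skew (θ : Ω ≃ᵐ Ω) (A : Ω → MaxMat k) (p : Ω × ProjSpace k) : Ω × ProjSpace k :=
  (θ p.1, act (A p.1) p.2)

theorem skew_iterate (hA : ∀ ω, Proper (A ω)) (n : ℕ) (p : Ω × ProjSpace k) :
    (skew θ A)^[n] p = (θ^[n] p.1, act (matProd θ A n p.1) p.2) := by
  induction n with
  | zero => exact Prod.ext rfl (act_one _).symm
  | succ n ih =>
    rw [Function.iterate_succ_apply', ih, act_matProd_succ hA, Function.iterate_succ_apply']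
    rfl

theorem measurable_skew (hM : IsRecurrentModel P θ A) : Measurable (skew θ A) := by
  refine (θ.measurable.comp measurable_fst).prodMk fun S hS => ?_
  have : (fun p : Ω × ProjSpace k => act (A p.1) p.2) ⁻¹' S =
      ⋃ C ∈ Set.range A, (A ⁻¹' {C}) ×ˢ (act C ⁻¹' S) := by
    ext p
    simp only [Set.mem_preimage, Set.mem_iUnion, Set.mem_prod, Set.mem_singleton_iff]
    constructor
    · exact fun h => ⟨A p.1, ⟨p.1, rfl⟩, rfl, h⟩
    · rintro ⟨C, -, hC, h⟩
      rwa [hC]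
  rw [this]
  refine MeasurableSet.biUnion hM.finite_range.countable ?_
  rintro _ ⟨ω, rfl⟩
  exact (hM.measurableSet_fiber _).prod (measurable_act (hM.proper ω) hS)

theorem IsStationarySolution.isStationaryRegime (hM : IsRecurrentModel P θ A)
    {Z : Ω → ProjSpace k} (hZ : IsStationarySolution P θ A Z) :
    IsStationaryRegime P θ A (P.map fun ω => (ω, Z ω)) := by
  have hg : Measurable fun ω => (ω, Z ω) := measurable_id.prodMk hZ.1
  constructor
  · rw [Measure.map_map measurable_fst hg]
    exact Measure.map_id
  · refine ⟨measurable_skew hM, ?_⟩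
    change (P.map fun ω => (ω, Z ω)).map (skew θ A) = _
    rw [Measure.map_map (measurable_skew hM) hg]
    conv_rhs => rw [← hM.measurePreserving.map_eq, Measure.map_map hg θ.measurable]
    refine Measure.map_congr ?_
    filter_upwards [hZ.2] with ω hω
    exact Prod.ext rfl hω.symm

/-! ### Collapse of the past and strong coupling -/

/-- The product `A(-1) ⊗ ⋯ ⊗ A(-n)` maps projective space to a point. -/
def Collapsed (θ : Ω ≃ᵐ Ω) (A : Ω → MaxMat k) (n : ℕ) (ω : Ω) : Prop :=
  ∃ c, ∀ z, back θ A n ω z = c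

theorem Collapsed.back_add (hA : ∀ ω, Proper (A ω)) {n : ℕ} {ω : Ω} (h : Collapsed θ A n ω)
    (l : ℕ) (z z' : ProjSpace k) : back θ A (n + l) ω z = back θ A n ω z' := by
  obtain ⟨c, hc⟩ := h
  rw [MaxPlus.back_add hA, hc, hc]

theorem Collapsed.mono (hA : ∀ ω, Proper (A ω)) {n m : ℕ} {ω : Ω} (h : Collapsed θ A n ω)
    (hnm : n ≤ m) : Collapsed θ A m ω := by
  obtain ⟨l, rfl⟩ := Nat.exists_eq_add_of_le hnm
  exact ⟨back θ A n ω (proj 0), fun z => h.back_add hA l z _⟩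

theorem Collapsed.apply_succ (hA : ∀ ω, Proper (A ω)) {n : ℕ} {ω : Ω} (h : Collapsed θ A n ω) :
    Collapsed θ A (n + 1) (θ ω) := by
  obtain ⟨c, hc⟩ := h
  exact ⟨act (A ω) c, fun z => by rw [back_succ_apply hA, hc]⟩

theorem measurableSet_collapsed (hM : IsRecurrentModel P θ A) (n : ℕ) :
    MeasurableSet {ω | Collapsed θ A n ω} :=
  θ.symm.measurable.iterate n
    (measurableSet_matProd hM.finite_range hM.measurableSet_fiber n {M | ∃ c, ∀ z, act M z = c})

theorem measurable_back (hM : IsRecurrentModel P θ A) (n : ℕ) (z : ProjSpace k) :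
    Measurable fun ω => back θ A n ω z := fun S _ =>
  θ.symm.measurable.iterate n
    (measurableSet_matProd hM.finite_range hM.measurableSet_fiber n {M | act M z ∈ S})

/-- A limit of the past: whenever the past has collapsed, `Z` is the point to which it has. -/
theorem exists_limit_back (hM : IsRecurrentModel P θ A) :
    ∃ Z : Ω → ProjSpace k, Measurable Z ∧
      ∀ n ω, Collapsed θ A n ω → ∀ z, back θ A n ω z = Z ω := by
  classical
  -- The second alternative provides a value of `n` at the points where there is no collapse.
  have hex : ∀ ω, ∃ n, Collapsed θ A n ω ∨ ∀ m, ¬ Collapsed θ A m ω := by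
    intro ω
    by_cases h : ∃ n, Collapsed θ A n ω
    · obtain ⟨n, hn⟩ := h
      exact ⟨n, Or.inl hn⟩
    · exact ⟨0, Or.inr (not_exists.1 h)⟩
  refine ⟨_, Measurable.find (fun n => measurable_back hM n (proj 0)) (fun n => ?_) hex, ?_⟩
  · refine (measurableSet_collapsed hM n).union ?_
    have : {ω | ∀ m, ¬ Collapsed θ A m ω} = ⋂ m, {ω | Collapsed θ A m ω}ᶜ := by
      ext ω
      simp
    change MeasurableSet {ω | ∀ m, ¬ Collapsed θ A m ω}
    rw [this]
    exact MeasurableSet.iInter fun m => (measurableSet_collapsed hM m).compl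
  · intro n ω h z
    have h' := (Nat.find_spec (hex ω)).resolve_right fun h' => h' n h
    obtain ⟨l, hl⟩ := Nat.exists_eq_add_of_le
      (Nat.find_min' (hex ω) (Or.inl h : Collapsed θ A n ω ∨ _))
    have h2 := h'.back_add hM.proper l z (proj 0)
    rw [← hl] at h2
    exact h2

theorem ae_exists_collapsed (hM : IsRecurrentModel P θ A) {N : ℕ}
    (h : 0 < P {ω | ∃ c, ∀ z, act (matProd θ A N ω) z = c}) :
    ∀ᵐ ω ∂P, ∃ n, Collapsed θ A n ω := by
  filter_upwards [hM.ae_exists N {M | ∃ c, ∀ z, act M z = c} h] with ω ⟨n, c, hc⟩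
  exact ⟨n + N, back θ A n ω c, fun z => by rw [back_add hM.proper, hc]⟩

theorem isStationarySolution_of_collapsed (hM : IsRecurrentModel P θ A) {Z : Ω → ProjSpace k}
    (hZm : Measurable Z) (hZ : ∀ n ω, Collapsed θ A n ω → ∀ z, back θ A n ω z = Z ω)
    (hc : ∀ᵐ ω ∂P, ∃ n, Collapsed θ A n ω) : IsStationarySolution P θ A Z := by
  refine ⟨hZm, ?_⟩
  filter_upwards [hc] with ω ⟨n, hn⟩
  rw [← hZ (n + 1) (θ ω) (hn.apply_succ hM.proper) (proj 0), back_succ_apply hM.proper, hZ n ω hn]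

theorem IsStationarySolution.ae_eq_of_collapsed (hM : IsRecurrentModel P θ A)
    {Z Z' : Ω → ProjSpace k} (hZ : ∀ n ω, Collapsed θ A n ω → ∀ z, back θ A n ω z = Z ω)
    (hc : ∀ᵐ ω ∂P, ∃ n, Collapsed θ A n ω) (hZ' : IsStationarySolution P θ A Z') :
    Z' =ᵐ[P] Z := by
  have h1 : ∀ n : ℕ, ∀ᵐ ω ∂P, Z' ω = back θ A n ω (Z' (θ.symm^[n] ω)) := by
    intro n
    have h2 : ∀ᵐ ω ∂P, Z' (θ^[n] ω) = act (matProd θ A n ω) (Z' ω) := by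
      induction n with
      | zero => exact Filter.Eventually.of_forall fun ω => (act_one _).symm
      | succ n ih =>
        filter_upwards [ih,
          (hM.measurePreserving.iterate n).quasiMeasurePreserving.ae hZ'.2] with ω h3 h4
        rw [Function.iterate_succ_apply', h4, h3, act_matProd_succ hM.proper]
    filter_upwards [((hM.measurePreserving.symm θ).iterate n).quasiMeasurePreserving.ae h2]
      with ω h3
    have h4 := iterate_iterate_symm θ 0 n ω
    rw [zero_add] at h4
    rw [h4] at h3
    exact h3
  filter_upwards [ae_all_iff.2 h1, hc] with ω h2 ⟨n, hn⟩
  rw [h2 n]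
  exact hZ n ω hn _

theorem stronglyCouples_of_collapsed (hM : IsRecurrentModel P θ A) {Z : Ω → ProjSpace k}
    (hZ : ∀ n ω, Collapsed θ A n ω → ∀ z, back θ A n ω z = Z ω)
    (hc : ∀ᵐ ω ∂P, ∃ n, Collapsed θ A n ω) (x₀ : Ω → Fin k → ℝ) :
    StronglyCouples P θ (fun n ω => proj (state θ A x₀ n ω)) Z := by
  filter_upwards [hc] with ω ⟨n, hn⟩
  refine ⟨n, fun l => ?_⟩
  rw [proj_state hM.proper]
  exact hZ (n + l) ω (hn.mono hM.proper (Nat.le_add_right n l)) _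

/-- Under collapse a regime is carried by the graph of `Z`: its mass is transported by the `n`-th
iterate of the skew product, which maps to the graph except over the points whose past of length
`n` has not collapsed. -/
theorem IsStationaryRegime.eq_map_of_collapsed [IsProbabilityMeasure P]
    (hM : IsRecurrentModel P θ A)
    {Z : Ω → ProjSpace k} (hZm : Measurable Z)
    (hZ : ∀ n ω, Collapsed θ A n ω → ∀ z, back θ A n ω z = Z ω)
    (hc : ∀ᵐ ω ∂P, ∃ n, Collapsed θ A n ω) {Q : Measure (Ω × ProjSpace k)}
    (hQ : IsStationaryRegime P θ A Q) : Q = P.map fun ω => (ω, Z ω) := by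
  have hg : Measurable fun ω => (ω, Z ω) := measurable_id.prodMk hZm
  have hfst : ∀ E : Set Ω, MeasurableSet E → Q (Prod.fst ⁻¹' E) = P E := by
    intro E hE
    rw [← Measure.map_apply measurable_fst hE, hQ.1]
  have hlim := tendsto_measure_iInter_atTop (μ := P) (s := fun n => {ω | Collapsed θ A n ω}ᶜ)
    (fun n => (measurableSet_collapsed hM n).compl.nullMeasurableSet)
    (fun a b hab => Set.compl_subset_compl.2 fun ω hω => Collapsed.mono hM.proper hω hab)
    ⟨0, measure_ne_top _ _⟩
  have hzero : P (⋂ n, {ω | Collapsed θ A n ω}ᶜ) = 0 := by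
    refine measure_mono_null ?_ (ae_iff.1 hc)
    intro ω hω hex
    obtain ⟨n, hn⟩ := hex
    exact Set.mem_iInter.1 hω n hn
  rw [hzero] at hlim
  have hle : Q ≤ P.map fun ω => (ω, Z ω) := by
    refine Measure.le_iff.2 fun S hS => ?_
    rw [Measure.map_apply hg hS]
    set S' : Set Ω := (fun ω => (ω, Z ω)) ⁻¹' S
    have hS' : MeasurableSet S' := hg hS
    have hbound : ∀ n, Q S ≤ P S' + P {ω | Collapsed θ A n ω}ᶜ := by
      intro n
      have hmp : MeasurePreserving (skew θ A)^[n] Q Q :=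
        MeasurePreserving.iterate (f := skew θ A) hQ.2 n
      have hθn := hM.measurePreserving.iterate n
      have hc' := (measurableSet_collapsed hM n).compl
      rw [← hmp.measure_preimage hS.nullMeasurableSet, ← hθn.measure_preimage
        hS'.nullMeasurableSet, ← hθn.measure_preimage hc'.nullMeasurableSet,
        ← hfst _ (hθn.measurable hS'), ← hfst _ (hθn.measurable hc')]
      refine (measure_mono ?_).trans (measure_union_le _ _)
      intro p hp
      by_cases hcol : Collapsed θ A n (θ^[n] p.1)
      · left
        have h1 := hZ n _ hcol p.2
        have h2 : θ.symm^[n] (θ^[n] p.1) = p.1 :=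
          Function.LeftInverse.iterate θ.symm_apply_apply n _
        rw [back, h2] at h1
        rw [Set.mem_preimage, skew_iterate hM.proper, h1] at hp
        exact hp
      · exact Or.inr hcol
    have := hlim.const_add (P S')
    rw [add_zero] at this
    exact ge_of_tendsto' this hbound
  have huniv : Q Set.univ = 1 := by
    rw [← Set.preimage_univ (f := Prod.fst), hfst _ MeasurableSet.univ, measure_univ]
  have : IsProbabilityMeasure Q := ⟨huniv⟩
  have : IsProbabilityMeasure (P.map fun ω => (ω, Z ω)) :=
    Measure.isProbabilityMeasure_map hg.aemeasurable
  exact Measure.eq_of_le_of_measure_univ_eq hle (by simp)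

end Regimes

section Attractor

variable {Ω : Type*} [MeasurableSpace Ω] {P : Measure Ω} {k : ℕ} {θ : Ω ≃ᵐ Ω} {A : Ω → MaxMat k}
  {Λ : Set (ProjSpace k)}

/-! ### The random attractor of a countable invariant set -/

/-- The set of points of `Λ` that remain after an infinite past. -/
def attractor (θ : Ω ≃ᵐ Ω) (A : Ω → MaxMat k) (Λ : Set (ProjSpace k)) (ω : Ω) :
    Set (ProjSpace k) :=
  ⋂ n, back θ A n ω '' Λ

theorem attractor_subset (ω : Ω) : attractor θ A Λ ω ⊆ Λ := by
  intro z hz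
  obtain ⟨y, hy, rfl⟩ := Set.mem_iInter.1 hz 0
  rw [show back θ A 0 ω y = y from act_one y]
  exact hy

theorem antitone_back_image (hA : ∀ ω, Proper (A ω)) (hΛ : ∀ ω, ∀ z ∈ Λ, act (A ω) z ∈ Λ)
    (ω : Ω) : Antitone fun n => back θ A n ω '' Λ := by
  intro n m hnm
  obtain ⟨l, rfl⟩ := Nat.exists_eq_add_of_le hnm
  rintro _ ⟨z, hz, rfl⟩
  exact ⟨_, act_matProd_mem hA hΛ l _ hz, (back_add hA n l ω z).symm⟩

/-- The images of `Λ` under the past are almost surely finite from some time on. Their cardinality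
decreases to the least cardinality of an image under a product of positive probability, which
recurrence makes appear, so that they are eventually constant. -/
theorem exists_encard_attractor (hM : IsRecurrentModel P θ A) (hne : Λ.Nonempty)
    (hΛ : ∀ ω, ∀ z ∈ Λ, act (A ω) z ∈ Λ) {N : ℕ}
    (hN : 0 < P {ω | (act (matProd θ A N ω) '' Λ).Finite}) :
    ∃ r : ℕ, r ≠ 0 ∧ ∀ᵐ ω ∂P, (attractor θ A Λ ω).encard = r ∧
      ∃ n, ∀ m ≥ n, back θ A m ω '' Λ = attractor θ A Λ ω := by
  classical
  have hex : ∃ r N : ℕ, 0 < P {ω | (act (matProd θ A N ω) '' Λ).encard = r} := by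
    have hU : {ω | (act (matProd θ A N ω) '' Λ).Finite} =
        ⋃ r : ℕ, {ω | (act (matProd θ A N ω) '' Λ).encard = r} := by
      ext ω
      rw [Set.mem_iUnion, Set.mem_ofPred_eq, ← Set.encard_ne_top_iff, ENat.ne_top_iff_exists]
      exact exists_congr fun r => eq_comm
    rw [hU] at hN
    obtain ⟨r, hr⟩ := exists_measure_pos_of_not_measure_iUnion_null hN.ne'
    exact ⟨r, N, hr⟩
  obtain ⟨M, hM'⟩ := Nat.find_spec hex
  refine ⟨Nat.find hex, ?_, ?_⟩
  · intro h0
    rw [h0] at hM'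
    refine hM'.ne' (measure_mono_null (fun ω hω => ?_) measure_empty)
    exact (hne.image _).ne_empty (Set.encard_eq_zero.1 hω)
  have hlow : ∀ n : ℕ, ∀ᵐ ω ∂P, (Nat.find hex : ℕ∞) ≤ (back θ A n ω '' Λ).encard := by
    intro n
    have h1 : ∀ᵐ ω ∂P, (Nat.find hex : ℕ∞) ≤ (act (matProd θ A n ω) '' Λ).encard := by
      have h2 : ∀ᵐ ω ∂P, ∀ r : ℕ, r < Nat.find hex →
          (act (matProd θ A n ω) '' Λ).encard ≠ r := by
        refine ae_all_iff.2 fun r => ?_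
        by_cases hr : r < Nat.find hex
        · have h3 := Nat.find_min hex hr
          rw [not_exists] at h3
          have h4 : ∀ᵐ ω ∂P, (act (matProd θ A n ω) '' Λ).encard ≠ r := by
            rw [ae_iff]
            simpa using h3 n
          filter_upwards [h4] with ω h5 _ using h5
        · exact Filter.Eventually.of_forall fun ω h => absurd h hr
      filter_upwards [h2] with ω h3
      by_contra! hlt
      obtain ⟨r, hr⟩ := ENat.ne_top_iff_exists.1 hlt.ne_top
      rw [← hr] at hlt
      exact h3 r (by exact_mod_cast hlt) hr.symm
    exact ((hM.measurePreserving.symm θ).iterate n).quasiMeasurePreserving.ae h1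
  filter_upwards [ae_all_iff.2 hlow, hM.ae_exists M
    {C | (act C '' Λ).encard = Nat.find hex} hM'] with ω h1 ⟨n, hn⟩
  have hup : (back θ A (n + M) ω '' Λ).encard ≤ Nat.find hex := by
    have : back θ A (n + M) ω '' Λ =
        back θ A n ω '' (act (matProd θ A M (θ.symm^[n + M] ω)) '' Λ) := by
      rw [Set.image_image]
      exact Set.image_congr fun z _ => back_add hM.proper n M ω z
    rw [this]
    exact (Set.encard_image_le _ _).trans hn.le
  have hanti := antitone_back_image (θ := θ) hM.proper hΛ ω
  have hfin : (back θ A (n + M) ω '' Λ).Finite :=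
    Set.finite_of_encard_le_coe hup
  have hconst : ∀ m ≥ n + M, back θ A m ω '' Λ = back θ A (n + M) ω '' Λ := fun m hm =>
    (hfin.subset (hanti hm)).eq_of_subset_of_encard_le (hanti hm) (hup.trans (h1 m))
  have hatt : attractor θ A Λ ω = back θ A (n + M) ω '' Λ := by
    refine Set.Subset.antisymm (Set.iInter_subset _ _) (Set.subset_iInter fun m => ?_)
    rcases le_total m (n + M) with h | h
    · exact hanti h
    · exact (hconst m h).ge
  rw [hatt]
  exact ⟨le_antisymm hup (h1 _), n + M, hconst⟩

theorem measurableSet_mem_attractor (hM : IsRecurrentModel P θ A) (z : ProjSpace k) :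
    MeasurableSet {ω | z ∈ attractor θ A Λ ω} := by
  have : {ω | z ∈ attractor θ A Λ ω} = ⋂ n, {ω | z ∈ back θ A n ω '' Λ} := by
    ext ω
    simp [attractor]
  rw [this]
  exact MeasurableSet.iInter fun n => θ.symm.measurable.iterate n
    (measurableSet_matProd hM.finite_range hM.measurableSet_fiber n {M | z ∈ act M '' Λ})

/-! ### The regime carried by the attractor -/

/-- The law of `(ω, z)` where `z` is uniformly distributed on the attractor of `ω`, the number of
points of which is almost surely `r`. -/
noncomputable def attractorRegime (P : Measure Ω) (θ : Ω ≃ᵐ Ω) (A : Ω → MaxMat k)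
    (Λ : Set (ProjSpace k)) (r : ℕ) : Measure (Ω × ProjSpace k) :=
  (r : ENNReal)⁻¹ • Measure.sum fun z : Λ =>
    (P.restrict {ω | (z : ProjSpace k) ∈ attractor θ A Λ ω}).map fun ω => (ω, (z : ProjSpace k))

theorem encard_attractor_eq_tsum (B : Set (Ω × ProjSpace k)) (ω : Ω) :
    ({z ∈ attractor θ A Λ ω | (ω, z) ∈ B}.encard : ENNReal) =
      ∑' z : Λ, ((fun ω => (ω, (z : ProjSpace k))) ⁻¹' B ∩
        {ω | (z : ProjSpace k) ∈ attractor θ A Λ ω}).indicator 1 ω := by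
  have himage : {z ∈ attractor θ A Λ ω | (ω, z) ∈ B} =
      Subtype.val '' {z : Λ | (z : ProjSpace k) ∈ attractor θ A Λ ω ∧
        (ω, (z : ProjSpace k)) ∈ B} := by
    ext z
    constructor
    · exact fun h => ⟨⟨z, attractor_subset ω h.1⟩, h, rfl⟩
    · rintro ⟨z, h, rfl⟩
      exact h
  rw [himage, Subtype.val_injective.encard_image, ← ENNReal.tsum_set_one,
    tsum_subtype _ fun _ => (1 : ENNReal)]
  refine tsum_congr fun z => ?_
  by_cases h1 : (z : ProjSpace k) ∈ attractor θ A Λ ω <;>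
    by_cases h2 : (ω, (z : ProjSpace k)) ∈ B <;> simp [Set.indicator, h1, h2]

theorem measurableSet_attractor_section (hM : IsRecurrentModel P θ A)
    {B : Set (Ω × ProjSpace k)} (hB : MeasurableSet B) (z : ProjSpace k) :
    MeasurableSet ((fun ω => (ω, z)) ⁻¹' B ∩ {ω | z ∈ attractor θ A Λ ω}) :=
  (measurable_prodMk_right hB).inter (measurableSet_mem_attractor hM z)

theorem measurable_encard_attractor (hM : IsRecurrentModel P θ A) (hc : Λ.Countable)
    {B : Set (Ω × ProjSpace k)} (hB : MeasurableSet B) :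
    Measurable fun ω => ({z ∈ attractor θ A Λ ω | (ω, z) ∈ B}.encard : ENNReal) := by
  have := hc.to_subtype
  simp only [encard_attractor_eq_tsum]
  exact Measurable.tsum fun z =>
    measurable_one.indicator (measurableSet_attractor_section hM hB z)

theorem attractorRegime_apply (hM : IsRecurrentModel P θ A) (hc : Λ.Countable) (r : ℕ)
    {B : Set (Ω × ProjSpace k)} (hB : MeasurableSet B) :
    attractorRegime P θ A Λ r B =
      (r : ENNReal)⁻¹ * ∫⁻ ω, ({z ∈ attractor θ A Λ ω | (ω, z) ∈ B}.encard : ENNReal) ∂P := by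
  have := hc.to_subtype
  simp only [encard_attractor_eq_tsum]
  rw [lintegral_tsum fun z : Λ =>
    (measurable_one.indicator (measurableSet_attractor_section hM hB z)).aemeasurable]
  rw [attractorRegime, Measure.smul_apply, Measure.sum_apply _ hB, smul_eq_mul]
  congr 1
  refine tsum_congr fun z => ?_
  rw [lintegral_indicator_one (measurableSet_attractor_section hM hB z),
    Measure.map_apply measurable_prodMk_right hB,
    Measure.restrict_apply (measurable_prodMk_right hB)]

/-- The matrix of `ω` maps the attractor of `ω` bijectively onto that of `θ ω`, since both have the
same finite cardinality; hence the uniform distributions are preserved. -/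
theorem isStationaryRegime_attractorRegime (hM : IsRecurrentModel P θ A) (hc : Λ.Countable)
    {r : ℕ} (hr : r ≠ 0)
    (h : ∀ᵐ ω ∂P, (attractor θ A Λ ω).encard = r ∧
      ∃ n, ∀ m ≥ n, back θ A m ω '' Λ = attractor θ A Λ ω) :
    IsStationaryRegime P θ A (attractorRegime P θ A Λ r) := by
  have hr0 : (r : ENNReal) ≠ 0 := by exact_mod_cast hr
  have hrt : (r : ENNReal) ≠ ⊤ := ENNReal.natCast_ne_top r
  constructor
  · ext E hE
    rw [Measure.map_apply measurable_fst hE, attractorRegime_apply hM hc r (measurable_fst hE)]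
    have hint : ∀ᵐ ω ∂P, ({z ∈ attractor θ A Λ ω | (ω, z) ∈ Prod.fst ⁻¹' E}.encard : ENNReal) =
        E.indicator (fun _ => (r : ENNReal)) ω := by
      filter_upwards [h] with ω hω
      by_cases hωE : ω ∈ E <;> simp [hωE, hω.1]
    rw [lintegral_congr_ae hint, lintegral_indicator_const hE, ← mul_assoc,
      ENNReal.inv_mul_cancel hr0 hrt, one_mul]
  · refine ⟨measurable_skew hM, ?_⟩
    ext B hB
    change Measure.map (skew θ A) _ B = _
    rw [Measure.map_apply (measurable_skew hM) hB,
      attractorRegime_apply hM hc r (measurable_skew hM hB), attractorRegime_apply hM hc r hB]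
    congr 1
    rw [← hM.measurePreserving.lintegral_comp_emb θ.measurableEmbedding
      fun ω => ({z ∈ attractor θ A Λ ω | (ω, z) ∈ B}.encard : ENNReal)]
    refine lintegral_congr_ae ?_
    filter_upwards [h, hM.measurePreserving.quasiMeasurePreserving.ae h]
      with ω ⟨hcard, n, hn⟩ ⟨hcard', n', hn'⟩
    have himage : attractor θ A Λ (θ ω) = act (A ω) '' attractor θ A Λ ω := by
      rw [← hn' (max n n' + 1) (by omega), ← hn (max n n') (by omega), Set.image_image]
      exact Set.image_congr fun z _ => back_succ_apply hM.proper _ ω z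
    have hinj : Set.InjOn (act (A ω)) (attractor θ A Λ ω) :=
      (Set.finite_of_encard_eq_coe hcard).injOn_of_encard_image_eq
        (by rw [← himage, hcard, hcard'])
    have hset : {z ∈ attractor θ A Λ (θ ω) | (θ ω, z) ∈ B} =
        act (A ω) '' {z ∈ attractor θ A Λ ω | (ω, z) ∈ skew θ A ⁻¹' B} := by
      rw [himage]
      ext z
      constructor
      · rintro ⟨⟨y, hy, rfl⟩, hB'⟩
        exact ⟨y, ⟨hy, hB'⟩, rfl⟩
      · rintro ⟨y, ⟨hy, hB'⟩, rfl⟩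
        exact ⟨⟨y, hy, rfl⟩, hB'⟩
    rw [hset, (hinj.mono (Set.sep_subset _ _)).encard_image]

theorem ae_attractor_subset (hM : IsRecurrentModel P θ A) (hc : Λ.Countable) {r : ℕ}
    {T : Set (ProjSpace k)} (hT : MeasurableSet T)
    (h : attractorRegime P θ A Λ r (Prod.snd ⁻¹' Tᶜ) = 0) :
    ∀ᵐ ω ∂P, attractor θ A Λ ω ⊆ T := by
  have hB : MeasurableSet (Prod.snd ⁻¹' Tᶜ : Set (Ω × ProjSpace k)) := measurable_snd hT.compl
  rw [attractorRegime_apply hM hc r hB, mul_eq_zero] at h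
  have h' := h.resolve_left (ENNReal.inv_ne_zero.2 (ENNReal.natCast_ne_top r))
  rw [lintegral_eq_zero_iff (measurable_encard_attractor hM hc hB)] at h'
  filter_upwards [h'] with ω hω z hz
  by_contra hzT
  have h0 : {z ∈ attractor θ A Λ ω | (ω, z) ∈ (Prod.snd ⁻¹' Tᶜ : Set (Ω × ProjSpace k))} = ∅ := by
    simpa using hω
  exact Set.notMem_empty z (h0 ▸ (⟨hz, hzT⟩ : z ∈ {z ∈ attractor θ A Λ ω |
    (ω, z) ∈ (Prod.snd ⁻¹' Tᶜ : Set (Ω × ProjSpace k))}))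

end Attractor

/-! ### Patterns -/

section Patterns

variable {Ω : Type*} [MeasurableSpace Ω] {P : Measure Ω} {k : ℕ} {θ : Ω ≃ᵐ Ω} {A : Ω → MaxMat k}

theorem mem_supBall_self (C : MaxMat k) {η : ℝ} (hη : 0 < η) : C ∈ supBall C η := by
  intro i j
  by_cases h : C i j = ⊥
  · exact Or.inl ⟨h, h⟩
  · obtain ⟨c, hc⟩ := exists_coe_of_ne_bot h
    exact Or.inr ⟨c, c, hc, hc, by simpa using hη⟩

theorem supBall_mono (C : MaxMat k) {η η' : ℝ} (h : η ≤ η') : supBall C η ⊆ supBall C η' := by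
  intro B hB i j
  refine (hB i j).imp_right ?_
  rintro ⟨c, b, hc, hb, hlt⟩
  exact ⟨c, b, hc, hb, hlt.trans_le h⟩

theorem eq_of_forall_mem_supBall {C B : MaxMat k} (h : ∀ η > 0, B ∈ supBall C η) : B = C := by
  funext i j
  rcases h 1 one_pos i j with ⟨hc, hb⟩ | ⟨c, b, hc, hb, -⟩
  · rw [hc, hb]
  rw [hc, hb]
  by_contra hne
  have hbc : b ≠ c := fun e => hne (by rw [e])
  rcases h |b - c| (abs_pos.2 (sub_ne_zero.2 hbc)) i j with ⟨hc', -⟩ | ⟨c', b', hc', hb', hlt⟩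
  · simp [hc] at hc'
  · rw [hc] at hc'
    rw [hb] at hb'
    obtain rfl : c = c' := by exact_mod_cast hc'
    obtain rfl : b = b' := by exact_mod_cast hb'
    exact lt_irrefl _ hlt

/-- Since products take finitely many values, a pattern is a value of positive probability. -/
theorem IsPattern.exists_pos (hM : IsRecurrentModel P θ A) {C : MaxMat k}
    (hC : IsPattern P θ A C) : ∃ N : ℕ, 0 < P {ω | matProd θ A N ω = C} := by
  obtain ⟨N, -, hpos⟩ := hC
  have hev : ∀ᶠ η in nhdsWithin (0 : ℝ) (Set.Ioi 0),
      ∀ B ∈ Set.range (matProd θ A N), B ∈ supBall C η → B = C := by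
    rw [Filter.eventually_all_finite
      (finite_range_matProd hM.finite_range hM.measurableSet_fiber N)]
    intro B _
    by_cases hB : B = C
    · exact Filter.Eventually.of_forall fun _ _ => hB
    · have h1 : ¬ ∀ η > 0, B ∈ supBall C η := fun h => hB (eq_of_forall_mem_supBall h)
      push Not at h1
      obtain ⟨η₀, h0, hη₀⟩ := h1
      filter_upwards [Ioc_mem_nhdsGT h0] with η hη hmem
      exact absurd (supBall_mono C hη.2 hmem) hη₀
  obtain ⟨η, hη, hpos'⟩ := (hev.and self_mem_nhdsWithin).exists
  exact ⟨N, (hpos η hpos').trans_le (measure_mono fun ω hω => hη _ ⟨ω, rfl⟩ hω)⟩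

theorem exists_isPattern_mem (hM : IsRecurrentModel P θ A) {N : ℕ} (hN : 1 ≤ N)
    {T : Set (MaxMat k)} (hT : 0 < P {ω | matProd θ A N ω ∈ T}) :
    ∃ C ∈ T, Proper C ∧ IsPattern P θ A C := by
  have hfin := finite_range_matProd (θ := θ) hM.finite_range hM.measurableSet_fiber N
  have := hfin.countable.to_subtype
  have hU : {ω | matProd θ A N ω ∈ T} =
      ⋃ C : Set.range (matProd θ A N), {ω | matProd θ A N ω = C ∧ (C : MaxMat k) ∈ T} := by
    ext ω
    simp only [Set.mem_ofPred_eq, Set.mem_iUnion]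
    constructor
    · exact fun h => ⟨⟨_, ω, rfl⟩, rfl, h⟩
    · rintro ⟨C, hC, h⟩
      rwa [hC]
  rw [hU] at hT
  obtain ⟨⟨C, ω₀, rfl⟩, hC⟩ := exists_measure_pos_of_not_measure_iUnion_null hT.ne'
  obtain ⟨ω, -, hmem⟩ := nonempty_of_measure_ne_zero hC.ne'
  refine ⟨_, hmem, proper_matProd hM.proper N ω₀, N, hN, fun η hη => hC.trans_le ?_⟩
  refine measure_mono fun ω hω => ?_
  rw [Set.mem_ofPred_eq, hω.1]
  exact mem_supBall_self _ hη

/-- Uniqueness forces the uniform regimes on the attractors of the lattices of mesh `1/q` and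
`1/(2q)` to coincide. Then some product maps the finer lattice into the coarser one, hence to a
point. -/
theorem HasUniqueStationaryRegime.exists_isPattern [IsProbabilityMeasure P] [NeZero k]
    (hM : IsRecurrentModel P θ A) {q : ℕ} (hq : 0 < q) (hA : ∀ ω, HasEntriesIn q (A ω)) {N : ℕ}
    (hD : 0 < P {ω | projDiam (matProd θ A N ω) < ⊤}) (h : HasUniqueStationaryRegime P θ A) :
    ∃ C : MaxMat k, IsOfRank C 1 ∧ IsPattern P θ A C := by
  have hex : ∀ m > 0, ∃ r : ℕ, IsStationaryRegime P θ A
      (attractorRegime P θ A (lattice k (m * q)) r) ∧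
      ∀ᵐ ω ∂P, ∃ n, ∀ l ≥ n, back θ A l ω '' lattice k (m * q) =
        attractor θ A (lattice k (m * q)) ω := by
    intro m hm
    have hinv : ∀ ω, ∀ z ∈ lattice k (m * q), act (A ω) z ∈ lattice k (m * q) :=
      fun ω z hz => ((hA ω).mul_left hm).act_mem_lattice (hM.proper ω) hz
    obtain ⟨r, hr, hae⟩ := exists_encard_attractor hM (lattice_nonempty k _) hinv (N := N)
      (hD.trans_le (measure_mono fun ω hω => finite_act_image_lattice (Nat.mul_pos hm hq) hω
        fun z hz => act_matProd_mem hM.proper hinv N ω hz))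
    exact ⟨r, isStationaryRegime_attractorRegime hM (countable_lattice k _) hr hae,
      hae.mono fun ω hω => hω.2⟩
  obtain ⟨r₁, hreg₁, -⟩ := hex 1 one_pos
  obtain ⟨r₂, hreg₂, hae⟩ := hex 2 two_pos
  rw [one_mul] at hreg₁
  have hmeas : MeasurableSet (lattice k q) := (countable_lattice k q).measurableSet
  have hnull : attractorRegime P θ A (lattice k (2 * q)) r₂ (Prod.snd ⁻¹' (lattice k q)ᶜ) = 0 := by
    rw [h.unique hreg₂ hreg₁, attractorRegime_apply hM (countable_lattice k q) r₁
      (measurable_snd hmeas.compl)]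
    have : ∀ ω, {z ∈ attractor θ A (lattice k q) ω |
        (ω, z) ∈ (Prod.snd ⁻¹' (lattice k q)ᶜ : Set (Ω × ProjSpace k))} = ∅ := by
      intro ω
      refine Set.eq_empty_of_forall_notMem fun z hz => hz.2 (attractor_subset ω hz.1)
    simp only [this, Set.encard_empty, ENat.toENNReal_zero, lintegral_zero, mul_zero]
  have hex' : ∀ᵐ ω ∂P, ∃ n, ∀ z ∈ lattice k (2 * q), back θ A (n + 1) ω z ∈ lattice k q := by
    filter_upwards [hae, ae_attractor_subset hM (countable_lattice k _) hmeas hnull]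
      with ω ⟨n, hn⟩ hsub
    exact ⟨n, fun z hz => hsub (hn (n + 1) (Nat.le_succ n) ▸ Set.mem_image_of_mem _ hz)⟩
  let T : Set (MaxMat k) := {M | ∀ z ∈ lattice k (2 * q), act M z ∈ lattice k q}
  obtain ⟨n, hn⟩ : ∃ n, 0 < P {ω | matProd θ A (n + 1) ω ∈ T} := by
    by_contra! hc
    have hall : ∀ᵐ ω ∂P, ∀ n, matProd θ A (n + 1) (θ.symm^[n + 1] ω) ∉ T := by
      refine ae_all_iff.2 fun n => ?_
      have h1 : ∀ᵐ ω ∂P, matProd θ A (n + 1) ω ∉ T := by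
        rw [ae_iff]
        simpa using hc n
      exact ((hM.measurePreserving.symm θ).iterate (n + 1)).quasiMeasurePreserving.ae h1
    obtain ⟨ω, ⟨n, h1⟩, h2⟩ := (hex'.and hall).exists
    exact h2 n h1
  obtain ⟨C, hCT, hCp, hC⟩ := exists_isPattern_mem hM (Nat.le_add_left 1 n) hn
  obtain ⟨c, hc⟩ := exists_act_eq_of_mapsTo_lattice hq hCp hCT
  exact ⟨C, isOfRank_one_of_act_eq hCp (Nat.mul_pos two_pos hq) hc, hC⟩

/-- A pattern of rank one makes the past collapse almost surely. -/
theorem IsPattern.ae_exists_collapsed [NeZero k] (hM : IsRecurrentModel P θ A) {C : MaxMat k}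
    (hC1 : IsOfRank C 1) (hC : IsPattern P θ A C) : ∀ᵐ ω ∂P, ∃ n, Collapsed θ A n ω := by
  obtain ⟨N, hN⟩ := hC.exists_pos hM
  refine MaxPlus.ae_exists_collapsed hM (N := N) (hN.trans_le (measure_mono fun ω hω => ?_))
  have hω' : matProd θ A N ω = C := hω
  have hp := proper_matProd (θ := θ) hM.proper N ω
  rw [hω'] at hp
  rw [Set.mem_ofPred_eq, hω']
  exact hC1.exists_act_eq hp

end Patterns

end MaxPlus

theorem mainTheorem2 {Ω : Type*} [MeasurableSpace Ω] (P : Measure Ω) [IsProbabilityMeasure P]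
    (θ : Ω ≃ᵐ Ω) (hθ : MeasurePreserving θ P P)
    (k : ℕ) (hk : 1 ≤ k) (A : Ω → MaxPlus.MaxMat k)
    (hfin : (Set.range A).Finite)
    (hmeas : ∀ C : MaxPlus.MaxMat k, MeasurableSet (A ⁻¹' {C}))
    (hirr : ∀ ω, MaxPlus.Irred (A ω))
    (hrat : ∀ ω, MaxPlus.HasRationalEntries (A ω))
    (hlaw : iIndepFun (m := fun _ : ℕ => (⊤ : MeasurableSpace (MaxPlus.MaxMat k)))
        (MaxPlus.matSeq θ A) P ∨ Ergodic θ P)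
    (hD : ∃ n : ℕ, 0 < P {ω | MaxPlus.projDiam (MaxPlus.matProd θ A (n + 1) ω) < ⊤}) :
    (MaxPlus.HasUniqueStationaryRegime P θ A ↔
      ∃ C : MaxPlus.MaxMat k, MaxPlus.IsOfRank C 1 ∧ MaxPlus.IsPattern P θ A C) ∧
    (MaxPlus.HasUniqueStationaryRegime P θ A →
      ∃ Z : Ω → MaxPlus.ProjSpace k,
        MaxPlus.IsStationarySolution P θ A Z ∧
        (∀ Z' : Ω → MaxPlus.ProjSpace k, MaxPlus.IsStationarySolution P θ A Z' → Z' =ᵐ[P] Z) ∧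
        MaxPlus.IsStationaryRegime P θ A (P.map fun ω => (ω, Z ω)) ∧
        ∀ x₀ : Ω → Fin k → ℝ, Measurable x₀ →
          MaxPlus.StronglyCouples P θ
            (fun n ω => MaxPlus.proj (MaxPlus.state θ A x₀ n ω)) Z) := by
  have : NeZero k := ⟨by omega⟩
  have hM := MaxPlus.isRecurrentModel hθ hfin hmeas (fun ω => (hirr ω).proper) hlaw
  obtain ⟨q, hq, hA⟩ := MaxPlus.exists_common_hasEntriesIn hfin
    (by rintro _ ⟨ω, rfl⟩; exact hrat ω)
  obtain ⟨N, hN⟩ := hD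
  have hpat : MaxPlus.HasUniqueStationaryRegime P θ A →
      ∃ C : MaxPlus.MaxMat k, MaxPlus.IsOfRank C 1 ∧ MaxPlus.IsPattern P θ A C :=
    fun h => h.exists_isPattern hM hq (fun ω => hA _ ⟨ω, rfl⟩) hN
  obtain ⟨Z, hZm, hZ⟩ := MaxPlus.exists_limit_back hM
  refine ⟨⟨hpat, ?_⟩, fun h => ?_⟩
  · rintro ⟨C, hC1, hC⟩
    have hc := hC.ae_exists_collapsed hM hC1
    exact ⟨_, (MaxPlus.isStationarySolution_of_collapsed hM hZm hZ hc).isStationaryRegime hM,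
      fun Q hQ => hQ.eq_map_of_collapsed hM hZm hZ hc⟩
  · obtain ⟨C, hC1, hC⟩ := hpat h
    have hc := hC.ae_exists_collapsed hM hC1
    have hsol := MaxPlus.isStationarySolution_of_collapsed hM hZm hZ hc
    exact ⟨Z, hsol, fun Z' hZ' => hZ'.ae_eq_of_collapsed hM hZ hc, hsol.isStationaryRegime hM,
      fun x₀ _ => MaxPlus.stronglyCouples_of_collapsed hM hZ hc x₀⟩
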